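/- Consider a cell-free network with $M$ access points (APs) of $N$ antennas each and $K$ single-antenna users (UEs). The channel between AP $m$ and UE $k$ is $\mathbf g_{mk}=\bar{\mathbf g}_{mk}e^{j\theta_{mk}}+\check{\mathbf g}_{mk}\in\mathbb C^N$, with $\bar{\mathbf g}_{mk}$ deterministic, $\theta_{mk}\sim\mathcal U[-\pi,\pi]$ and $\check{\mathbf g}_{mk}\sim\mathcal N_{\mathbb C}(\mathbf 0,\check{\mathbf R}_{mk})$. UE $k$ has power $p_k\ge 0$ and sends the pilot $\boldsymbol\phi_{t_k}$, one of $\tau_p$ mutually orthogonal vectors of $\mathbb C^{\tau_p}$ with $\|\boldsymbol\phi_t\|^2=\tau_p$; $\mathcal P_k=\{l:t_l=t_k\}$. AP $m$ receives $\mathbf Y_m^p=\sum_{k=1}^K\sqrt{p_k}\,\mathbf g_{mk}\boldsymbol\phi_{t_k}^T+\mathbf N_m^p\in\mathbb C^{N\times\tau_p}$, where the entries of the $\mathbf N_m^p$ are $\mathcal N_{\mathbb C}(0,\sigma^2)$, $\sigma^2>0$. All the $\theta_{mk}$, all the $\check{\mathbf g}_{mk}$ and all the noise entries are mutually independent. Let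 $\mathbf y_{mk}^p=\mathbf Y_m^p\boldsymbol\phi_{t_k}^*$ and $\bar{\mathbf y}_{mk}^p=\sum_{l\in\mathcal P_k}\sqrt{p_l}\tau_p\bar{\mathbf g}_{ml}e^{j\theta_{ml}}$. Stack over the APs $\mathbf g_k=[\mathbf g_{1k}^T,\dots,\mathbf g_{Mk}^T]^T\in\mathbb C^{MN}$, and likewise $\bar{\mathbf g}_k=[\bar{\mathbf g}_{1k}^Te^{j\theta_{1k}},\dots,\bar{\mathbf g}_{Mk}^Te^{j\theta_{Mk}}]^T$, $\mathbf y_k^p$, $\bar{\mathbf y}_k^p$. Put $\check{\mathbf R}_k=\mathrm{diag}(\check{\mathbf R}_{1k},\dots,\check{\mathbf R}_{Mk})$, $\mathbf\Psi_k=\sum_{l\in\mathcal P_k}p_l\tau_p\check{\mathbf R}_l+\sigma^2\mathbf I_{MN}$, and let $$\hat{\mathbf g}_k=\bar{\mathbf g}_k+\sqrt{p_k}\,\check{\mathbf R}_k\mathbf\Psi_k^{-1}(\mathbf y_k^p-\bar{\mathbf y}_k^p)$$ be the phase-aware MMSE estimate of $\mathbf g_k$. Let $\tau_c\ge\tau_p$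 be the length of the coherence block, fix a UE $k$, let $\mathbf W_k\in\mathbb C^{MN\times MN}$ be any deterministic matrix, and let $\mathbf v_k=\mathbf W_k\hat{\mathbf g}_k$. The use-and-then-forget (UatF) achievable SE of UE $k$ is $\mathrm{SE}_k=\frac{\tau_c-\tau_p}{\tau_c}\log_2(1+\mathrm{SINR}_k)$ with $$\mathrm{SINR}_k=\frac{p_k|\mathbb E\{\mathbf v_k^H\mathbf g_k\}|^2}{\sum_{l=1}^Kp_l\mathbb E\{|\mathbf v_k^H\mathbf g_l|^2\}-p_k|\mathbb E\{\mathbf v_k^H\mathbf g_k\}|^2+\sigma^2\mathbb E\{\|\mathbf v_k\|^2\}}.$$ Then all these expectations exist, the denominator is positive unless $\mathbf v_k=\mathbf 0$ almost surely, and $\mathrm{SE}_k=\frac{\tau_c-\tau_p}{\tau_c}\log_2(1+\overline{\mathrm{SINR}}_k)$, $\mathrm{SINR}_k=\overline{\mathrm{SINR}}_k$, where $$\overline{\mathrm{SINR}}_k=\frac{p_k|\mathrm{tr}(\mathbf W_k^H\bar{\mathbf R}_k)|^2}{\sum_{l=1}^Kp_l\mu_{kl}+\sum_{l\in\mathcal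 P_k}p_l\varepsilon_{kl}+p_k\omega_k-p_k|\mathrm{tr}(\mathbf W_k^H\bar{\mathbf R}_k)|^2+\sigma^2\mathrm{tr}(\mathbf W_k\bar{\mathbf R}_k\mathbf W_k^H)}$$ (both quotients being read as $0$ in the degenerate case $\mathbf v_k=\mathbf 0$ almost surely). Here $\bar{\mathbf G}_{m_1m_2kk}=\bar{\mathbf g}_{m_1k}\bar{\mathbf g}_{m_2k}^H$, $\bar{\mathbf G}_{mkk}=\bar{\mathbf g}_{mk}\bar{\mathbf g}_{mk}^H$, $\bar{\mathbf G}_{kk}=\mathrm{diag}(\bar{\mathbf G}_{1kk},\dots,\bar{\mathbf G}_{Mkk})$, $\hat{\mathbf R}_k=p_k\tau_p\check{\mathbf R}_k\mathbf\Psi_k^{-1}\check{\mathbf R}_k$, $\bar{\mathbf R}_k=\bar{\mathbf G}_{kk}+\hat{\mathbf R}_k$, $\mathbf W_{k,m_1m_2}$ is the $(m_1,m_2)$-th $N\times N$ block of $\mathbf W_k$, $\mathbf W_{k,m_1m_2}^H=(\mathbf W_{k,m_1m_2})^H$, and $$\mu_{kl}=\mathrm{tr}(\mathbf W_k^H\bar{\mathbf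 G}_{ll}\mathbf W_k\bar{\mathbf G}_{kk})+\mathrm{tr}(\mathbf W_k^H\check{\mathbf R}_l\mathbf W_k\bar{\mathbf G}_{kk})+\mathrm{tr}(\mathbf W_k^H\bar{\mathbf G}_{ll}\mathbf W_k\hat{\mathbf R}_k)+\mathrm{tr}(\mathbf W_k^H\check{\mathbf R}_l\mathbf W_k\hat{\mathbf R}_k),$$ $$\varepsilon_{kl}=p_kp_l\tau_p^2|\mathrm{tr}(\mathbf W_k^H\check{\mathbf R}_l\mathbf\Psi_k^{-1}\check{\mathbf R}_k)|^2,$$ $$\begin{aligned}\omega_k={}&p_k\tau_p\mathrm{tr}(\mathbf W_k^H\check{\mathbf R}_k\mathbf\Psi_k^{-1}\check{\mathbf R}_k)\mathrm{tr}(\mathbf W_k\bar{\mathbf G}_{kk})+p_k\tau_p\mathrm{tr}(\mathbf W_k^H\bar{\mathbf G}_{kk})\mathrm{tr}(\mathbf W_k\check{\mathbf R}_k\mathbf\Psi_k^{-1}\check{\mathbf R}_k)-\mathrm{tr}(\mathbf W_k^H\bar{\mathbf G}_{kk}\mathbf W_k\bar{\mathbf G}_{kk})\\&+\sum_{m_1=1}^M\sum_{m_2\ne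 m_1}\big[\mathrm{tr}(\mathbf W_{k,m_1m_1}^H\bar{\mathbf G}_{m_1m_2kk}\mathbf W_{k,m_2m_2}\bar{\mathbf G}_{m_1m_2kk}^H)+\mathrm{tr}(\mathbf W_{k,m_2m_1}^H\bar{\mathbf G}_{m_2kk}\mathbf W_{k,m_2m_1}\bar{\mathbf G}_{m_1kk})\big]\\&+\sum_{m_1=1}^M\mathrm{tr}(\mathbf W_{k,m_1m_1}^H\bar{\mathbf G}_{m_1kk}\mathbf W_{k,m_1m_1}\bar{\mathbf G}_{m_1kk}).\end{aligned}$$ -/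

import Mathlib

open MeasureTheory ProbabilityTheory
open scoped Matrix NNReal ComplexOrder

noncomputable section

namespace CellFree

/-! ### Circularly symmetric complex Gaussian laws -/

/-- The law `𝒩_ℂ(0, v)` on `ℂ`: independent real and imaginary parts, each `𝒩(0, v / 2)`. -/
def complexGaussian (v : ℝ≥0) : Measure ℂ :=
  ((gaussianReal 0 (v / 2)).prod (gaussianReal 0 (v / 2))).map
    (fun x : ℝ × ℝ => (⟨x.1, x.2⟩ : ℂ))

/-- The law `𝒩_ℂ(0, I)` on `ℂ^n`: independent `𝒩_ℂ(0, 1)` entries. -/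
def stdComplexGaussian (n : ℕ) : Measure (Fin n → ℂ) :=
  Measure.pi fun _ => complexGaussian 1

/-- `X ∼ 𝒩_ℂ(0, R)`: `X` has the law of `S q`, where `q ∼ 𝒩_ℂ(0, I)` and `S Sᴴ = R`
(this law does not depend on the choice of the square factor `S`). -/
def IsComplexGaussian {Ω : Type*} [MeasurableSpace Ω] {n : ℕ} (X : Ω → Fin n → ℂ)
    (R : Matrix (Fin n) (Fin n) ℂ) (P : Measure Ω) : Prop :=
  ∃ S : Matrix (Fin n) (Fin n) ℂ, S * Sᴴ = R ∧
    HasLaw X ((stdComplexGaussian n).map fun q => S *ᵥ q) P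

/-! ### Deterministic parameters of the network -/

/-- A cell-free network with `M` APs of `N` antennas each, `K` single-antenna UEs and
`τp` mutually orthogonal pilots. -/
structure Network (M N K τp : ℕ) where
  /-- the LoS component `ḡ_mk ∈ ℂ^N` (without its random phase) -/
  los : Fin M → Fin K → Fin N → ℂ
  /-- the spatial correlation matrix `Ř_mk` of the NLoS component -/
  corr : Fin M → Fin K → Matrix (Fin N) (Fin N) ℂ
  corr_posSemidef : ∀ m k, (corr m k).PosSemidef
  /-- the transmit power `p_k` -/
  power : Fin K → ℝ
  power_nonneg : ∀ k, 0 ≤ power k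
  /-- `σ`; the noise power is `σ ^ 2` -/
  sigma : ℝ
  sigma_pos : 0 < sigma
  /-- the pilot signals `φ_1, …, φ_τp` -/
  pilot : Fin τp → Fin τp → ℂ
  pilot_orthogonal : ∀ s t, s ≠ t → star (pilot s) ⬝ᵥ pilot t = 0
  pilot_norm_sq : ∀ t, ∑ i, ‖pilot t i‖ ^ 2 = (τp : ℝ)
  /-- the index `t_k` of the pilot sent by UE `k` -/
  pilotIndex : Fin K → Fin τp

/-! ### Random quantities of a coherence block -/

/-- The random phases, NLoS components and pilot noise of a coherence block. -/
structure Block {M N K τp : ℕ} (S : Network M N K τp) (Ω : Type*) [MeasurableSpace Ω]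
    (P : Measure Ω) where
  /-- the phase-shift `θ_mk` -/
  phase : Fin M → Fin K → Ω → ℝ
  /-- the NLoS component `ǧ_mk` -/
  nlos : Fin M → Fin K → Ω → Fin N → ℂ
  /-- the entries of the noise matrix `N_m^p ∈ ℂ^{N × τp}` -/
  noise : Fin M → Fin N → Fin τp → Ω → ℂ
  phase_uniform : ∀ m k, pdf.IsUniform (phase m k) (Set.Icc (-Real.pi) Real.pi) P volume
  nlos_gaussian : ∀ m k, IsComplexGaussian (nlos m k) (S.corr m k) P
  noise_gaussian : ∀ m n i, HasLaw (noise m n i) (complexGaussian (S.sigma ^ 2).toNNReal) P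
  phase_indep : iIndepFun (fun x : Fin M × Fin K => phase x.1 x.2) P
  nlos_indep : iIndepFun (fun x : Fin M × Fin K => nlos x.1 x.2) P
  noise_indep : iIndepFun (fun x : Fin M × Fin N × Fin τp => noise x.1 x.2.1 x.2.2) P
  /-- the phases, the NLoS components and the noise are mutually independent -/
  phase_indep_nlos_noise : IndepFun (fun ω m k => phase m k ω)
    (fun ω => ((fun m k => nlos m k ω : Fin M → Fin K → Fin N → ℂ),
      (fun m n i => noise m n i ω : Fin M → Fin N → Fin τp → ℂ))) P
  nlos_indep_noise : IndepFun (fun ω m k => nlos m k ω) (fun ω m n i => noise m n i ω) P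

/-! ### Statistics: collective vectors and matrices

The coordinates of `ℂ^{MN}` are indexed by pairs `(n, m)`: antenna `n` of AP `m`. -/

/-- The index set of the coordinates of `ℂ^{MN}`. -/
abbrev Idx (M N : ℕ) : Type := Fin N × Fin M

namespace Network

variable {M N K τp : ℕ} (S : Network M N K τp)

/-- `𝒫_k`: the UEs that use the same pilot as UE `k`, including UE `k`. -/
def copilot (k : Fin K) : Finset (Fin K) :=
  Finset.univ.filter fun l => S.pilotIndex l = S.pilotIndex k

/-- `Ψ_mk = ∑_{l ∈ 𝒫_k} p_l τp Ř_ml + σ² I_N`. -/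
def psiAP (m : Fin M) (k : Fin K) : Matrix (Fin N) (Fin N) ℂ :=
  ∑ l ∈ S.copilot k, ((S.power l * τp : ℝ) : ℂ) • S.corr m l
    + ((S.sigma ^ 2 : ℝ) : ℂ) • (1 : Matrix (Fin N) (Fin N) ℂ)

/-- `Ψ_k = diag(Ψ_1k, …, Ψ_Mk)`. -/
def psi (k : Fin K) : Matrix (Idx M N) (Idx M N) ℂ :=
  Matrix.blockDiagonal fun m => S.psiAP m k

/-- `Ř_k = diag(Ř_1k, …, Ř_Mk)`. -/
def corrAll (k : Fin K) : Matrix (Idx M N) (Idx M N) ℂ :=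
  Matrix.blockDiagonal fun m => S.corr m k

/-- `R̂_k = p_k τp Ř_k Ψ_k⁻¹ Ř_k`. -/
def estCorr (k : Fin K) : Matrix (Idx M N) (Idx M N) ℂ :=
  ((S.power k * τp : ℝ) : ℂ) • (S.corrAll k * (S.psi k)⁻¹ * S.corrAll k)

/-- `Ḡ_{m₁m₂kk} = ḡ_{m₁k} ḡ_{m₂k}ᴴ`. -/
def losCross (m₁ m₂ : Fin M) (k : Fin K) : Matrix (Fin N) (Fin N) ℂ :=
  Matrix.vecMulVec (S.los m₁ k) (star (S.los m₂ k))

/-- `Ḡ_mkk = ḡ_mk ḡ_mkᴴ`. -/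
def losGramAP (m : Fin M) (k : Fin K) : Matrix (Fin N) (Fin N) ℂ :=
  Matrix.vecMulVec (S.los m k) (star (S.los m k))

/-- `Ḡ_kk = diag(Ḡ_1kk, …, Ḡ_Mkk)`. -/
def losGram (k : Fin K) : Matrix (Idx M N) (Idx M N) ℂ :=
  Matrix.blockDiagonal fun m => S.losGramAP m k

/-- `R̄_k = Ḡ_kk + p_k τp Ř_k Ψ_k⁻¹ Ř_k`. -/
def totalCorr (k : Fin K) : Matrix (Idx M N) (Idx M N) ℂ :=
  S.losGram k + ((S.power k * τp : ℝ) : ℂ) • (S.corrAll k * (S.psi k)⁻¹ * S.corrAll k)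

end Network

/-- The `(m₁, m₂)`-th `N × N` sub-matrix of an `MN × MN` matrix. -/
def subBlock {M N : ℕ} (W : Matrix (Idx M N) (Idx M N) ℂ) (m₁ m₂ : Fin M) :
    Matrix (Fin N) (Fin N) ℂ :=
  W.submatrix (fun n => (n, m₁)) (fun n => (n, m₂))

/-! ### Channels, pilots and the phase-aware MMSE estimate -/

namespace Block

variable {M N K τp : ℕ} {S : Network M N K τp} {Ω : Type*} [MeasurableSpace Ω]
  {P : Measure Ω} (B : Block S Ω P)

/-- The phase-rotated LoS component `ḡ_mk e^{jθ_mk}`. -/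
def losAP (m : Fin M) (k : Fin K) (ω : Ω) : Fin N → ℂ :=
  Complex.exp (Complex.I * B.phase m k ω) • S.los m k

/-- The channel `g_mk = ḡ_mk e^{jθ_mk} + ǧ_mk`. -/
def channelAP (m : Fin M) (k : Fin K) (ω : Ω) : Fin N → ℂ :=
  B.losAP m k ω + B.nlos m k ω

/-- The received pilot signal `Y_m^p = ∑_k √p_k g_mk φ_{t_k}ᵀ + N_m^p`. -/
def receivedPilot (m : Fin M) (ω : Ω) : Matrix (Fin N) (Fin τp) ℂ :=
  ∑ k, (Real.sqrt (S.power k) : ℂ) •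
      Matrix.vecMulVec (B.channelAP m k ω) (S.pilot (S.pilotIndex k))
    + Matrix.of fun n i => B.noise m n i ω

/-- The despread pilot signal `y_mk^p = Y_m^p φ_{t_k}^*`. -/
def despreadAP (m : Fin M) (k : Fin K) (ω : Ω) : Fin N → ℂ :=
  B.receivedPilot m ω *ᵥ star (S.pilot (S.pilotIndex k))

/-- Its phase-aware mean `ȳ_mk^p = ∑_{l ∈ 𝒫_k} √p_l τp ḡ_ml e^{jθ_ml}`. -/
def despreadMeanAP (m : Fin M) (k : Fin K) (ω : Ω) : Fin N → ℂ :=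
  ∑ l ∈ S.copilot k, ((Real.sqrt (S.power l) * τp : ℝ) : ℂ) • B.losAP m l ω

/-- The collective LoS component of UE `k`, with its phases. -/
def losAll (k : Fin K) (ω : Ω) : Idx M N → ℂ := fun i => B.losAP i.2 k ω i.1

/-- The collective channel `g_k = [g_1kᵀ, …, g_Mkᵀ]ᵀ`. -/
def channel (k : Fin K) (ω : Ω) : Idx M N → ℂ := fun i => B.channelAP i.2 k ω i.1

/-- `y_k^p - ȳ_k^p`, stacked over the APs. -/
def innovation (k : Fin K) (ω : Ω) : Idx M N → ℂ :=
  fun i => B.despreadAP i.2 k ω i.1 - B.despreadMeanAP i.2 k ω i.1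

/-- The phase-aware MMSE estimate `ĝ_k = ḡ_k + √p_k Ř_k Ψ_k⁻¹ (y_k^p - ȳ_k^p)`. -/
def estimate (k : Fin K) (ω : Ω) : Idx M N → ℂ :=
  B.losAll k ω
    + (Real.sqrt (S.power k) : ℂ) • ((S.corrAll k * (S.psi k)⁻¹) *ᵥ B.innovation k ω)

/-- The bilinear-equalizer combining vector `v_k = W_k ĝ_k`. -/
def combiner (W : Matrix (Idx M N) (Idx M N) ℂ) (k : Fin K) (ω : Ω) : Idx M N → ℂ :=
  W *ᵥ B.estimate k ω

/-! ### The use-and-then-forget bound of an arbitrary combining vector `v` -/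

variable (v : Ω → Idx M N → ℂ)

/-- `p_k |E{vᴴ g_k}|²`. -/
def uatfNum (k : Fin K) : ℝ :=
  S.power k * ‖∫ ω, star (v ω) ⬝ᵥ B.channel k ω ∂P‖ ^ 2

/-- `∑_l p_l E{|vᴴ g_l|²} - p_k |E{vᴴ g_k}|² + σ² E{‖v‖²}` (Euclidean norm). -/
def uatfDen (k : Fin K) : ℝ :=
  ∑ l, S.power l * ∫ ω, ‖star (v ω) ⬝ᵥ B.channel l ω‖ ^ 2 ∂P
    - S.power k * ‖∫ ω, star (v ω) ⬝ᵥ B.channel k ω ∂P‖ ^ 2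
    + S.sigma ^ 2 * ∫ ω, ∑ i, ‖v ω i‖ ^ 2 ∂P

/-- The UatF effective SINR of UE `k`. -/
def uatfSINR (k : Fin K) : ℝ := B.uatfNum v k / B.uatfDen v k

/-- The UatF achievable SE of UE `k`, with `τc` channel uses per coherence block. -/
def uatfSE (τc : ℕ) (k : Fin K) : ℝ :=
  ((τc : ℝ) - τp) / τc * Real.logb 2 (1 + B.uatfSINR v k)

end Block

/-! ### The closed form -/

namespace Network

variable {M N K τp : ℕ} (S : Network M N K τp) (W : Matrix (Idx M N) (Idx M N) ℂ)

/-- `μ_kl`. -/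
def mu (k l : Fin K) : ℂ :=
  (Wᴴ * S.losGram l * W * S.losGram k).trace
    + (Wᴴ * S.corrAll l * W * S.losGram k).trace
    + (Wᴴ * S.losGram l * W * S.estCorr k).trace
    + (Wᴴ * S.corrAll l * W * S.estCorr k).trace

/-- `ε_kl`. -/
def eps (k l : Fin K) : ℝ :=
  S.power k * S.power l * (τp : ℝ) ^ 2 *
    ‖(Wᴴ * S.corrAll l * (S.psi k)⁻¹ * S.corrAll k).trace‖ ^ 2

/-- `ω_k`. -/
def omega (k : Fin K) : ℂ :=
  ((S.power k * τp : ℝ) : ℂ) * (Wᴴ * S.corrAll k * (S.psi k)⁻¹ * S.corrAll k).trace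
      * (W * S.losGram k).trace
    + ((S.power k * τp : ℝ) : ℂ) * (Wᴴ * S.losGram k).trace
      * (W * S.corrAll k * (S.psi k)⁻¹ * S.corrAll k).trace
    - (Wᴴ * S.losGram k * W * S.losGram k).trace
    + ∑ m₁, ∑ m₂ ∈ Finset.univ.filter (fun m₂ => m₁ ≠ m₂),
        (((subBlock W m₁ m₁)ᴴ * S.losCross m₁ m₂ k * subBlock W m₂ m₂
            * (S.losCross m₁ m₂ k)ᴴ).trace
          + ((subBlock W m₂ m₁)ᴴ * S.losGramAP m₂ k * subBlock W m₂ m₁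
            * S.losGramAP m₁ k).trace)
    + ∑ m₁, ((subBlock W m₁ m₁)ᴴ * S.losGramAP m₁ k * subBlock W m₁ m₁
        * S.losGramAP m₁ k).trace

/-- The closed-form SINR, a complex expression in traces. -/
def closedSINR (k : Fin K) : ℂ :=
  ((S.power k * ‖(Wᴴ * S.totalCorr k).trace‖ ^ 2 : ℝ) : ℂ) /
    (∑ l, (S.power l : ℂ) * S.mu W k l
      + ∑ l ∈ S.copilot k, (S.power l : ℂ) * (S.eps W k l : ℂ)
      + (S.power k : ℂ) * S.omega W k
      - ((S.power k * ‖(Wᴴ * S.totalCorr k).trace‖ ^ 2 : ℝ) : ℂ)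
      + ((S.sigma ^ 2 : ℝ) : ℂ) * (W * S.totalCorr k * Wᴴ).trace)

/-- The closed-form SE (the real part is taken only for typing: `closedSINR` is real). -/
def closedSE (τc : ℕ) (k : Fin K) : ℝ :=
  ((τc : ℝ) - τp) / τc * Real.logb 2 (1 + (S.closedSINR W k).re)

end Network

end CellFree

end

/-!
The proof rests on one fact about quadratic forms. Let `x` be a vector of independent complex
variables with `E x_i = E x_i² = 0`, `E |x_i|² = 1` and `E |x_i|⁴ = κ_i`. Then `E {xᴴ Q x} = tr Q`
and `E {|xᴴ Q x|²} = |tr Q|² + ‖Q‖_F² + ∑ i, (κ_i - 2) |Q_ii|²`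
(`integral_quadraticForm`, `integral_norm_sq_quadraticForm`): in `E {x̄_a x_b x_c x̄_d}` only the
pairings `a = b, c = d` and `a = c, b = d` survive, and `κ_i` corrects for both holding at once.

All the randomness of a coherence block is a linear image of such a vector. Its coordinates are the
phase factors `e^{jθ_mk}` (with `κ = 1`) and standard complex Gaussians (with `κ = 2`) generating
the NLoS components and the noise (`Block.exists_identDistrib_primitives`). Hence `ĝ_k = A x` and
`g_l = B_l x` in law, `v_kᴴ g_l = xᴴ Q x` with `Q = (W A)ᴴ B_l`, and `‖v_k‖²` is a quadratic form
too.

The closed form then follows from the Gram matrices `A Aᴴ = R̄_k`, `B_l B_lᴴ = Ḡ_ll + Ř_l` and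
`B_l Aᴴ`, which has the part `Ḡ_kk` if `l = k` and a multiple of `Ř_l Ψ_k⁻¹ Ř_k` if `l ∈ 𝒫_k`:
`‖Q‖_F²` is `μ_kl`; `|tr Q|²` is `ε_kl` for copilot users `l ≠ k`; and for `l = k` the remainder
of `|tr Q|²` together with the phase correction `-∑ m, |Q_mm|²` is `ω_k` (`omega_eq`).
Positivity of the denominator is `|E X|² ≤ E |X|²` together with `σ² E ‖v_k‖² > 0`.
-/

noncomputable section

namespace CellFree

/-! ### Quadratic forms in independent circular variables -/

/-- A probability law on `ℂ` with the moments of a circularly symmetric variable up to the order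
needed here: mean `0`, pseudo-variance `E[z²] = 0`, variance `1` and fourth absolute moment `κ`.
The third-order moments are not constrained, as they never enter a second moment of a quadratic
form in independent centred variables. -/
structure IsCircular (ν : Measure ℂ) (κ : ℝ) : Prop where
  isProbabilityMeasure : IsProbabilityMeasure ν
  integrable_norm_pow_four : Integrable (fun z : ℂ => ‖z‖ ^ 4) ν
  integral_id : ∫ z, z ∂ν = 0
  integral_sq : ∫ z, z ^ 2 ∂ν = 0
  integral_norm_sq : ∫ z, ‖z‖ ^ 2 ∂ν = 1
  integral_norm_pow_four : ∫ z, ‖z‖ ^ 4 ∂ν = κ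

section Moments

/-- The mixed moment `E[z̄ ^ p z ^ q]` of a law on `ℂ`. -/
def mixedMoment (ν : Measure ℂ) (p q : ℕ) : ℂ := ∫ z, star z ^ p * z ^ q ∂ν

variable {ν : Measure ℂ} {κ : ℝ}

lemma IsCircular.integrable_mixed (h : IsCircular ν κ) {p q : ℕ} (hpq : p + q ≤ 4) :
    Integrable (fun z : ℂ => star z ^ p * z ^ q) ν := by
  have := h.isProbabilityMeasure
  refine ((integrable_const (1 : ℝ)).add h.integrable_norm_pow_four).mono'
    (by fun_prop) (Filter.Eventually.of_forall fun z => ?_)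
  rw [norm_mul, norm_pow, norm_pow, norm_star, ← pow_add, Pi.add_apply]
  rcases le_total ‖z‖ 1 with hz | hz
  · exact (pow_le_one₀ (norm_nonneg z) hz).trans (le_add_of_nonneg_right (by positivity))
  · exact (pow_le_pow_right₀ hz hpq).trans (le_add_of_nonneg_left zero_le_one)

lemma mixedMoment_swap (p q : ℕ) : mixedMoment ν q p = star (mixedMoment ν p q) := by
  simp only [mixedMoment, Complex.star_def, ← integral_conj]
  congr 1; ext z; simp [mul_comm]

lemma IsCircular.mixedMoment_zero_zero (h : IsCircular ν κ) : mixedMoment ν 0 0 = 1 := by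
  have := h.isProbabilityMeasure
  simp [mixedMoment]

lemma IsCircular.mixedMoment_zero_one (h : IsCircular ν κ) : mixedMoment ν 0 1 = 0 := by
  simpa [mixedMoment] using h.integral_id

lemma IsCircular.mixedMoment_one_zero (h : IsCircular ν κ) : mixedMoment ν 1 0 = 0 := by
  rw [mixedMoment_swap, h.mixedMoment_zero_one, star_zero]

lemma IsCircular.mixedMoment_two_zero (h : IsCircular ν κ) : mixedMoment ν 2 0 = 0 := by
  rw [mixedMoment_swap, mixedMoment]
  simpa using h.integral_sq

lemma mixedMoment_diag (p : ℕ) : mixedMoment ν p p = ((∫ z, ‖z‖ ^ (2 * p) ∂ν : ℝ) : ℂ) := by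
  rw [mixedMoment, ← integral_complex_ofReal]
  congr 1; ext z
  rw [← mul_pow, Complex.star_def, Complex.conj_mul']
  push_cast; rw [pow_mul]

lemma IsCircular.mixedMoment_one_one (h : IsCircular ν κ) : mixedMoment ν 1 1 = 1 := by
  rw [mixedMoment_diag, mul_one, h.integral_norm_sq, Complex.ofReal_one]

lemma IsCircular.mixedMoment_two_two (h : IsCircular ν κ) : mixedMoment ν 2 2 = κ := by
  rw [mixedMoment_diag, h.integral_norm_pow_four]

end Moments

section QuadraticForm

variable {ι : Type*} [Fintype ι]

lemma star_dotProduct_mulVec (Q : Matrix ι ι ℂ) (x : ι → ℂ) :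
    star x ⬝ᵥ Q *ᵥ x = ∑ a, ∑ b, Q a b * (star (x a) * x b) := by
  simp only [dotProduct, Matrix.mulVec, Finset.mul_sum, Pi.star_apply]
  exact Finset.sum_congr rfl fun a _ => Finset.sum_congr rfl fun b _ => by ring

lemma norm_sq_quadraticForm (Q : Matrix ι ι ℂ) (x : ι → ℂ) :
    ((‖star x ⬝ᵥ Q *ᵥ x‖ ^ 2 : ℝ) : ℂ) = ∑ a, ∑ b, ∑ c, ∑ d, Q a b * star (Q c d) *
      (star (x a) * x b * star (star (x c) * x d)) := by
  rw [Complex.ofReal_pow, ← Complex.conj_mul', star_dotProduct_mulVec]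
  simp only [map_sum, Finset.sum_mul, Finset.mul_sum]
  exact Finset.sum_congr rfl fun a _ => Finset.sum_congr rfl fun b _ =>
    Finset.sum_congr rfl fun c _ => Finset.sum_congr rfl fun d _ => by
      simp only [map_mul, Complex.star_def, Complex.conj_conj]; ring

variable [DecidableEq ι] {ν : ι → Measure ℂ} {κ : ι → ℝ}

lemma prod_pow_ite_eq (x : ι → ℂ) (a : ι) : ∏ i, x i ^ (if i = a then 1 else 0) = x a := by
  simp [pow_ite]

lemma star_mul_eq_prod (x : ι → ℂ) (a b : ι) :
    star (x a) * x b = ∏ i, star (x i) ^ (if i = a then 1 else 0) *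
      x i ^ (if i = b then 1 else 0) := by
  rw [Finset.prod_mul_distrib, prod_pow_ite_eq (fun i => star (x i)), prod_pow_ite_eq]

lemma star_mul_mul_star_eq_prod (x : ι → ℂ) (a b c d : ι) :
    star (x a) * x b * star (star (x c) * x d) =
      ∏ i, star (x i) ^ ((if i = a then 1 else 0) + (if i = d then 1 else 0)) *
        x i ^ ((if i = b then 1 else 0) + (if i = c then 1 else 0)) := by
  simp only [Finset.prod_mul_distrib, pow_add, prod_pow_ite_eq (fun i => star (x i)),
    prod_pow_ite_eq x, star_mul, star_star]
  ring

lemma integrable_star_mul (h : ∀ i, IsCircular (ν i) (κ i)) (a b : ι) :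
    Integrable (fun x : ι → ℂ => star (x a) * x b) (Measure.pi ν) := by
  have := fun i => (h i).isProbabilityMeasure
  simp_rw [star_mul_eq_prod]
  exact Integrable.fintype_prod fun i => (h i).integrable_mixed (by split_ifs <;> norm_num)

lemma integrable_star_mul_mul_star (h : ∀ i, IsCircular (ν i) (κ i)) (a b c d : ι) :
    Integrable (fun x : ι → ℂ => star (x a) * x b * star (star (x c) * x d)) (Measure.pi ν) := by
  have := fun i => (h i).isProbabilityMeasure
  simp_rw [star_mul_mul_star_eq_prod]
  exact Integrable.fintype_prod fun i => (h i).integrable_mixed (by split_ifs <;> norm_num)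

lemma integral_star_mul (h : ∀ i, IsCircular (ν i) (κ i)) (a b : ι) :
    ∫ x : ι → ℂ, star (x a) * x b ∂(Measure.pi ν) = if a = b then 1 else 0 := by
  have := fun i => (h i).isProbabilityMeasure
  simp_rw [star_mul_eq_prod]
  rw [integral_fintype_prod_eq_prod (f := fun i z => star z ^ (if i = a then 1 else 0) *
      z ^ (if i = b then 1 else 0))]
  change ∏ i, mixedMoment (ν i) _ _ = _
  split_ifs with hab
  · subst hab
    refine Finset.prod_eq_one fun i _ => ?_
    split_ifs
    · exact (h i).mixedMoment_one_one
    · exact (h i).mixedMoment_zero_zero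
  · refine Finset.prod_eq_zero (Finset.mem_univ a) ?_
    simpa [hab] using (h a).mixedMoment_one_zero

/-- The fourth-order moments of independent circular variables. Unless the indices pair up as
`a = b, c = d` or `a = c, b = d`, some index contributes a factor `E[z]` or `E[z²]` (or its
conjugate), which vanishes. -/
lemma integral_star_mul_mul_star (h : ∀ i, IsCircular (ν i) (κ i)) (a b c d : ι) :
    ∫ x : ι → ℂ, star (x a) * x b * star (star (x c) * x d) ∂(Measure.pi ν) =
      (if a = b then (if c = d then 1 else 0) else 0)
        + (if a = c then (if b = d then 1 else 0) else 0)
        + (if a = b then (if a = c then (if a = d then ((κ a - 2 : ℝ) : ℂ) else 0) else 0)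
            else 0) := by
  have := fun i => (h i).isProbabilityMeasure
  simp_rw [star_mul_mul_star_eq_prod]
  rw [integral_fintype_prod_eq_prod (f := fun i z =>
      star z ^ ((if i = a then 1 else 0) + (if i = d then 1 else 0)) *
        z ^ ((if i = b then 1 else 0) + (if i = c then 1 else 0)))]
  change ∏ i, mixedMoment (ν i) _ _ = _
  have h00 := fun i => (h i).mixedMoment_zero_zero
  have h01 := fun i => (h i).mixedMoment_zero_one
  have h10 := fun i => (h i).mixedMoment_one_zero
  have h11 := fun i => (h i).mixedMoment_one_one
  have h20 := fun i => (h i).mixedMoment_two_zero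
  have h22 := fun i => (h i).mixedMoment_two_two
  by_cases had : a = d
  · subst had
    by_cases hab : a = b
    · subst hab
      by_cases hac : a = c
      · subst hac
        rw [Finset.prod_eq_single a (fun i _ hi => by simp [hi, h00]) (by simp)]
        simp only [if_true, Nat.reduceAdd, h22]
        push_cast; ring
      · rw [Finset.prod_eq_zero (Finset.mem_univ c) (by simp [Ne.symm hac, h01])]
        simp [hac, Ne.symm hac]
    · by_cases hac : a = c
      · subst hac
        rw [Finset.prod_eq_zero (Finset.mem_univ b) (by simp [Ne.symm hab, h01])]
        simp [hab, Ne.symm hab]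
      · rw [Finset.prod_eq_zero (Finset.mem_univ a) (by simp [hab, hac, h20])]
        simp [hab, hac]
  · by_cases hab : a = b
    · subst hab
      by_cases hcd : c = d
      · subst hcd
        rw [Finset.prod_eq_one fun i _ => ?_]
        · simp [had]
        · by_cases h1 : i = a
          · subst h1; simp [had, h11]
          · by_cases h2 : i = c
            · subst h2; simp [h1, h11]
            · simp [h1, h2, h00]
      · rw [Finset.prod_eq_zero (Finset.mem_univ d)
          (by simp [Ne.symm had, Ne.symm hcd, h10])]
        simp [had, hcd]
    · by_cases hac : a = c
      · subst hac
        by_cases hbd : b = d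
        · subst hbd
          rw [Finset.prod_eq_one fun i _ => ?_]
          · simp [had]
          · by_cases h1 : i = a
            · subst h1; simp [had, h11]
            · by_cases h2 : i = b
              · subst h2; simp [h1, h11]
              · simp [h1, h2, h00]
        · rw [Finset.prod_eq_zero (Finset.mem_univ d)
            (by simp [Ne.symm had, Ne.symm hbd, h10])]
          simp [hab, hbd]
      · rw [Finset.prod_eq_zero (Finset.mem_univ a) (by simp [hab, hac, had, h10])]
        simp [hab, hac]

lemma integrable_quadraticForm (h : ∀ i, IsCircular (ν i) (κ i)) (Q : Matrix ι ι ℂ) :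
    Integrable (fun x => star x ⬝ᵥ Q *ᵥ x) (Measure.pi ν) := by
  simp_rw [star_dotProduct_mulVec]
  exact integrable_finsetSum _ fun a _ => integrable_finsetSum _ fun b _ =>
    (integrable_star_mul h a b).const_mul _

lemma integral_quadraticForm (h : ∀ i, IsCircular (ν i) (κ i)) (Q : Matrix ι ι ℂ) :
    ∫ x, star x ⬝ᵥ Q *ᵥ x ∂(Measure.pi ν) = Q.trace := by
  simp_rw [star_dotProduct_mulVec]
  have hi := fun a b => (integrable_star_mul h a b).const_mul (Q a b)
  rw [integral_finsetSum _ fun a _ => integrable_finsetSum _ fun b _ => hi a b]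
  simp_rw [integral_finsetSum _ fun b _ => hi _ b, integral_const_mul, integral_star_mul h]
  simp [Matrix.trace]

lemma integrable_norm_sq_quadraticForm (h : ∀ i, IsCircular (ν i) (κ i)) (Q : Matrix ι ι ℂ) :
    Integrable (fun x => ‖star x ⬝ᵥ Q *ᵥ x‖ ^ 2) (Measure.pi ν) := by
  have : Integrable (fun x => ((‖star x ⬝ᵥ Q *ᵥ x‖ ^ 2 : ℝ) : ℂ)) (Measure.pi ν) := by
    simp_rw [norm_sq_quadraticForm]
    exact integrable_finsetSum _ fun a _ => integrable_finsetSum _ fun b _ =>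
      integrable_finsetSum _ fun c _ => integrable_finsetSum _ fun d _ =>
      (integrable_star_mul_mul_star h a b c d).const_mul _
  simpa only [RCLike.re_to_complex, Complex.ofReal_re] using this.re

/-- The second moment of a quadratic form in independent circular variables. For Gaussian
coordinates (`κ = 2`) this is Wick's formula; any other coordinate contributes its excess
kurtosis through the diagonal of `Q`. -/
theorem integral_norm_sq_quadraticForm (h : ∀ i, IsCircular (ν i) (κ i)) (Q : Matrix ι ι ℂ) :
    ∫ x, ‖star x ⬝ᵥ Q *ᵥ x‖ ^ 2 ∂(Measure.pi ν) =
      ‖Q.trace‖ ^ 2 + ∑ a, ∑ b, ‖Q a b‖ ^ 2 + ∑ a, (κ a - 2) * ‖Q a a‖ ^ 2 := by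
  apply Complex.ofReal_injective
  rw [← integral_complex_ofReal]
  simp_rw [norm_sq_quadraticForm]
  have hi := fun a b c d => (integrable_star_mul_mul_star h a b c d).const_mul
    (Q a b * star (Q c d))
  rw [integral_finsetSum _ fun a _ => integrable_finsetSum _ fun b _ =>
      integrable_finsetSum _ fun c _ => integrable_finsetSum _ fun d _ => hi a b c d]
  simp_rw [integral_finsetSum _ fun b _ => integrable_finsetSum _ fun c _ =>
      integrable_finsetSum _ fun d _ => hi _ b c d,
    integral_finsetSum _ fun c _ => integrable_finsetSum _ fun d _ => hi _ _ c d,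
    integral_finsetSum _ fun d _ => hi _ _ _ d,
    integral_const_mul, integral_star_mul_mul_star h]
  simp only [mul_add, Finset.sum_add_distrib, mul_ite, mul_one, mul_zero, Complex.ofReal_add,
    Complex.ofReal_pow, Complex.ofReal_sum, Complex.ofReal_mul, ← Complex.mul_conj']
  congr 2
  · simp [Matrix.trace, Finset.sum_mul_sum, Finset.sum_ite_irrel]
  · simp [Finset.sum_ite_irrel]
  · simp [Finset.sum_ite_irrel, mul_comm]

end QuadraticForm

/-! ### The circular laws of the model -/

section Gaussian

lemma integrable_pow_gaussianReal (v : ℝ≥0) (n : ℕ) :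
    Integrable (fun x : ℝ => x ^ n) (gaussianReal 0 v) := by
  refine (integrable_norm_iff (by fun_prop)).1 ?_
  simpa using MemLp.integrable_norm_pow' (memLp_id_gaussianReal (μ := 0) (v := v) n)

lemma integral_sq_gaussianReal (v : ℝ≥0) : ∫ x, x ^ 2 ∂(gaussianReal 0 v) = v := by
  have h := variance_fun_id_gaussianReal (μ := 0) (v := v)
  rwa [variance_of_integral_eq_zero (by fun_prop) integral_id_gaussianReal] at h

/-- The fourth moment of a centred Gaussian. With `x`, `y` independent of variance `v`, both
`x + y` and `√2 x` have variance `2 v`; comparing their fourth moments determines it. -/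
lemma integral_pow_four_gaussianReal (v : ℝ≥0) :
    ∫ x, x ^ 4 ∂(gaussianReal 0 v) = 3 * (v : ℝ) ^ 2 := by
  set γ := gaussianReal 0 v
  have hp := fun n => integrable_pow_gaussianReal v n
  have h1 : ∫ x, x ^ 4 ∂(gaussianReal 0 (v + v)) = 4 * ∫ x, x ^ 4 ∂γ := by
    have : gaussianReal 0 (v + v) = γ.map (Real.sqrt 2 * ·) := by
      rw [gaussianReal_map_const_mul]
      congr 1
      · simp
      · ext; push_cast; simp; ring
    rw [this, integral_map (by fun_prop) (by fun_prop)]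
    simp_rw [mul_pow]
    rw [integral_const_mul]
    congr 1
    rw [show 4 = 2 * 2 from rfl, pow_mul, Real.sq_sqrt (by norm_num)]; norm_num
  have h2 : ∫ x, x ^ 4 ∂(gaussianReal 0 (v + v)) = 2 * ∫ x, x ^ 4 ∂γ + 6 * (v : ℝ) ^ 2 := by
    have hc : gaussianReal 0 (v + v) = (γ.prod γ).map (fun x => x.1 + x.2) := by
      have := gaussianReal_conv_gaussianReal (m₁ := 0) (m₂ := 0) (v₁ := v) (v₂ := v)
      rw [add_zero] at this
      rw [← this]; rfl
    rw [hc, integral_map (by fun_prop) (by fun_prop)]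
    have e : ∀ x : ℝ × ℝ, (x.1 + x.2) ^ 4 = x.1 ^ 4 * x.2 ^ 0 + 4 * (x.1 ^ 3 * x.2 ^ 1)
        + 6 * (x.1 ^ 2 * x.2 ^ 2) + 4 * (x.1 ^ 1 * x.2 ^ 3) + x.1 ^ 0 * x.2 ^ 4 :=
      fun x => by ring
    have hi : ∀ a b : ℕ, Integrable (fun x : ℝ × ℝ => x.1 ^ a * x.2 ^ b) (γ.prod γ) :=
      fun a b => (hp a).mul_prod (hp b)
    have hv : ∀ a b : ℕ, ∫ x : ℝ × ℝ, x.1 ^ a * x.2 ^ b ∂(γ.prod γ) =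
        (∫ x, x ^ a ∂γ) * ∫ x, x ^ b ∂γ := fun a b =>
      integral_prod_mul (μ := γ) (ν := γ) (fun x : ℝ => x ^ a) (fun x : ℝ => x ^ b)
    have m0 : ∫ x, x ^ 0 ∂γ = 1 := by simp [γ]
    have m1 : ∫ x, x ^ 1 ∂γ = 0 := by simp [γ]
    have m2 : ∫ x, x ^ 2 ∂γ = v := integral_sq_gaussianReal v
    have i1 := hi 4 0
    have i2 := i1.add ((hi 3 1).const_mul 4)
    have i3 := i2.add ((hi 2 2).const_mul 6)
    have i4 := i3.add ((hi 1 3).const_mul 4)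
    rw [integral_congr_ae (Filter.Eventually.of_forall e)]
    refine (integral_add i4 (hi 0 4)).trans ?_
    rw [integral_add' i3 ((hi 1 3).const_mul 4), integral_add' i2 ((hi 2 2).const_mul 6),
      integral_add' i1 ((hi 3 1).const_mul 4)]
    simp only [integral_const_mul, hv, m0, m1, m2]
    ring
  linarith

lemma measurable_complex_mk : Measurable (fun x : ℝ × ℝ => (⟨x.1, x.2⟩ : ℂ)) :=
  Complex.measurableEquivRealProd.symm.measurable

instance (v : ℝ≥0) : IsProbabilityMeasure (complexGaussian v) :=
  Measure.isProbabilityMeasure_map measurable_complex_mk.aemeasurable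

lemma isCircular_complexGaussian : IsCircular (complexGaussian 1) 2 := by
  set γ := gaussianReal 0 (1 / 2)
  have hi : ∀ a b : ℕ, Integrable (fun x : ℝ × ℝ => x.1 ^ a * x.2 ^ b) (γ.prod γ) :=
    fun a b => (integrable_pow_gaussianReal _ a).mul_prod (integrable_pow_gaussianReal _ b)
  have hv : ∀ a b : ℕ, ∫ x : ℝ × ℝ, x.1 ^ a * x.2 ^ b ∂(γ.prod γ) =
      (∫ x, x ^ a ∂γ) * ∫ x, x ^ b ∂γ := fun a b =>
    integral_prod_mul (μ := γ) (ν := γ) (fun x : ℝ => x ^ a) (fun x : ℝ => x ^ b)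
  have hm := measurable_complex_mk
  have m0 : ∫ x, x ^ 0 ∂γ = 1 := by simp
  have m1 : ∫ x, x ^ 1 ∂γ = 0 := by simp [γ]
  have m2 : ∫ x, x ^ 2 ∂γ = 1 / 2 := by rw [integral_sq_gaussianReal]; simp
  have m4 : ∫ x, x ^ 4 ∂γ = 3 / 4 := by rw [integral_pow_four_gaussianReal]; norm_num
  have n2 : ∀ x : ℝ × ℝ, ‖(⟨x.1, x.2⟩ : ℂ)‖ ^ 2 = x.1 ^ 2 * x.2 ^ 0 + x.1 ^ 0 * x.2 ^ 2 :=
    fun x => by rw [Complex.sq_norm, Complex.normSq_mk]; ring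
  have n4 : ∀ x : ℝ × ℝ, ‖(⟨x.1, x.2⟩ : ℂ)‖ ^ 4 =
      x.1 ^ 4 * x.2 ^ 0 + 2 * (x.1 ^ 2 * x.2 ^ 2) + x.1 ^ 0 * x.2 ^ 4 :=
    fun x => by rw [show 4 = 2 * 2 from rfl, pow_mul, n2]; ring
  have i4 : Integrable (fun x : ℝ × ℝ => ‖(⟨x.1, x.2⟩ : ℂ)‖ ^ 4) (γ.prod γ) := by
    simp_rw [n4]
    exact ((hi _ _).add ((hi _ _).const_mul _)).add (hi _ _)
  have hc : ∀ a b : ℕ, Integrable (fun x : ℝ × ℝ => ((x.1 ^ a * x.2 ^ b : ℝ) : ℂ)) (γ.prod γ) :=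
    fun a b => (hi a b).ofReal
  refine ⟨inferInstance, ?_, ?_, ?_, ?_, ?_⟩
  · rw [complexGaussian, integrable_map_measure (by fun_prop) hm.aemeasurable]
    exact i4
  · rw [complexGaussian, integral_map hm.aemeasurable (by fun_prop)]
    have e : ∀ x : ℝ × ℝ, (⟨x.1, x.2⟩ : ℂ) = ((x.1 ^ 1 * x.2 ^ 0 : ℝ) : ℂ)
        + ((x.1 ^ 0 * x.2 ^ 1 : ℝ) : ℂ) * Complex.I := fun x => by simp [Complex.ext_iff]
    rw [integral_congr_ae (Filter.Eventually.of_forall e),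
      integral_add (hc 1 0) ((hc 0 1).mul_const _), integral_mul_const, integral_complex_ofReal,
      integral_complex_ofReal, hv, hv, m0, m1]
    simp
  · rw [complexGaussian, integral_map hm.aemeasurable (by fun_prop)]
    have e : ∀ x : ℝ × ℝ, (⟨x.1, x.2⟩ : ℂ) ^ 2 = ((x.1 ^ 2 * x.2 ^ 0 : ℝ) : ℂ)
        - ((x.1 ^ 0 * x.2 ^ 2 : ℝ) : ℂ) + ((x.1 ^ 1 * x.2 ^ 1 : ℝ) : ℂ) * (2 * Complex.I) :=
      fun x => by
        simp only [Complex.ext_iff, sq, Complex.mul_re, Complex.mul_im, Complex.add_re,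
          Complex.add_im, Complex.sub_re, Complex.sub_im, Complex.ofReal_re, Complex.ofReal_im,
          Complex.I_re, Complex.I_im, Complex.re_ofNat, Complex.im_ofNat]
        constructor <;> ring
    rw [integral_congr_ae (Filter.Eventually.of_forall e)]
    refine (integral_add ((hc 2 0).sub (hc 0 2)) ((hc 1 1).mul_const _)).trans ?_
    rw [integral_sub' (hc 2 0) (hc 0 2), integral_mul_const, integral_complex_ofReal,
      integral_complex_ofReal, integral_complex_ofReal, hv, hv, hv, m0, m1, m2]
    simp
  · rw [complexGaussian, integral_map hm.aemeasurable (by fun_prop)]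
    simp_rw [n2]
    rw [integral_add (hi _ _) (hi _ _), hv, hv, m0, m2]; norm_num
  · rw [complexGaussian, integral_map hm.aemeasurable (by fun_prop)]
    rw [integral_congr_ae (Filter.Eventually.of_forall n4)]
    refine (integral_add ((hi 4 0).add ((hi 2 2).const_mul 2)) (hi 0 4)).trans ?_
    rw [integral_add' (hi 4 0) ((hi 2 2).const_mul 2), integral_const_mul, hv, hv, hv, m0, m2, m4]
    norm_num

lemma complexGaussian_eq_map (s : ℝ) (hs : 0 < s) :
    complexGaussian (s ^ 2).toNNReal = (complexGaussian 1).map (fun z => (s : ℂ) * z) := by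
  have hg : gaussianReal 0 ((s ^ 2).toNNReal / 2) = (gaussianReal 0 (1 / 2)).map (s * ·) := by
    rw [gaussianReal_map_const_mul]
    congr 1
    · simp
    · ext; simp [hs.le]; ring
  rw [complexGaussian, complexGaussian, hg, Measure.map_prod_map _ _ (by fun_prop) (by fun_prop),
    Measure.map_map measurable_complex_mk (by fun_prop),
    Measure.map_map (by fun_prop) measurable_complex_mk]
  congr 1
  ext x
  simp [Complex.ext_iff]

end Gaussian

section Phase

/-- The law of `e^{jθ}` for a phase `θ` uniform on `[-π, π]`. -/
def phaseLaw : Measure ℂ :=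
  (cond volume (Set.Icc (-Real.pi) Real.pi)).map fun θ : ℝ => Complex.exp (Complex.I * θ)

lemma volume_Icc_pi : (volume (Set.Icc (-Real.pi) Real.pi)) = ENNReal.ofReal (2 * Real.pi) := by
  rw [Real.volume_Icc]; congr 1; ring

lemma isProbabilityMeasure_cond_Icc_pi :
    IsProbabilityMeasure (cond volume (Set.Icc (-Real.pi) Real.pi)) := by
  apply cond_isProbabilityMeasure_of_finite
  · rw [volume_Icc_pi]; simp [Real.pi_pos]
  · rw [volume_Icc_pi]; exact ENNReal.ofReal_ne_top

lemma integral_exp_phase (n : ℕ) (hn : n ≠ 0) :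
    ∫ θ : ℝ, Complex.exp (Complex.I * θ) ^ n ∂(cond volume (Set.Icc (-Real.pi) Real.pi)) = 0 := by
  rw [ProbabilityTheory.cond, integral_smul_measure, integral_Icc_eq_integral_Ioc,
    ← intervalIntegral.integral_of_le (by linarith [Real.pi_pos])]
  have hc : (n : ℂ) * Complex.I ≠ 0 := by simp [hn]
  have : ∀ θ : ℝ, Complex.exp (Complex.I * θ) ^ n = Complex.exp (n * Complex.I * θ) := fun θ => by
    rw [← Complex.exp_nat_mul]; ring_nf
  simp_rw [this]
  rw [integral_exp_mul_complex hc]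
  have h : Complex.exp (n * Complex.I * (Real.pi : ℝ)) =
      Complex.exp (n * Complex.I * ((-Real.pi : ℝ) : ℂ)) := by
    rw [Complex.exp_eq_exp_iff_exists_int]
    exact ⟨n, by push_cast; ring⟩
  rw [h]; simp

lemma isCircular_phaseLaw : IsCircular phaseLaw 1 := by
  have := isProbabilityMeasure_cond_Icc_pi
  have hm : Measurable fun θ : ℝ => Complex.exp (Complex.I * θ) := by fun_prop
  have hn : ∀ θ : ℝ, ‖Complex.exp (Complex.I * θ)‖ = 1 := fun θ => by
    rw [mul_comm]; exact Complex.norm_exp_ofReal_mul_I θ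
  refine ⟨Measure.isProbabilityMeasure_map hm.aemeasurable, ?_, ?_, ?_, ?_, ?_⟩
  · rw [phaseLaw, integrable_map_measure (by fun_prop) hm.aemeasurable]
    simp [Function.comp_def, hn]
  all_goals rw [phaseLaw, integral_map hm.aemeasurable (by fun_prop)]
  · simpa using integral_exp_phase 1 one_ne_zero
  · exact integral_exp_phase 2 two_ne_zero
  · simp [hn]
  · simp [hn]

end Phase

/-! ### The joint law of the phases, NLoS components and noise -/

section Source

variable {M N K τp : ℕ}

/-- Index set of the independent circular variables that generate a coherence block: one phase
factor per AP and UE, `N` Gaussians per NLoS component, and one Gaussian per noise entry. -/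
abbrev SourceIdx (M N K τp : ℕ) : Type :=
  (Fin M × Fin K) ⊕ (((Fin M × Fin K) × Fin N) ⊕ (Fin M × Fin N × Fin τp))

/-- The laws of the generating variables: `e^{jθ}` for the phases and `𝒩_ℂ(0, 1)` otherwise. -/
def sourceLaw : SourceIdx M N K τp → Measure ℂ :=
  Sum.elim (fun _ => phaseLaw) (fun _ => complexGaussian 1)

/-- The fourth absolute moments of the generating variables. -/
def sourceKurtosis : SourceIdx M N K τp → ℝ := Sum.elim (fun _ => 1) (fun _ => 2)

lemma isCircular_sourceLaw (i : SourceIdx M N K τp) :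
    IsCircular (sourceLaw i) (sourceKurtosis i) := by
  rcases i with i | i
  · exact isCircular_phaseLaw
  · exact isCircular_complexGaussian

instance (i : SourceIdx M N K τp) : IsProbabilityMeasure (sourceLaw i) :=
  (isCircular_sourceLaw i).isProbabilityMeasure

/-- The matrices `C_mk` are square factors of the correlation matrices: `C_mk C_mkᴴ = Ř_mk`. -/
def Factors (S : Network M N K τp) (C : Fin M → Fin K → Matrix (Fin N) (Fin N) ℂ) : Prop :=
  ∀ m k, C m k * (C m k)ᴴ = S.corr m k

/-- The values of the phase factors, the NLoS components and the noise entries. -/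
abbrev Primitives (M N K τp : ℕ) : Type :=
  (Fin M × Fin K → ℂ) × (Fin M × Fin K → Fin N → ℂ) × (Fin M × Fin N × Fin τp → ℂ)

/-- The phase factors, NLoS components `C_mk q_mk` and noise entries generated by `x`. -/
def primitivesOfSource (S : Network M N K τp) (C : Fin M → Fin K → Matrix (Fin N) (Fin N) ℂ)
    (x : SourceIdx M N K τp → ℂ) : Primitives M N K τp :=
  (fun p => x (.inl p), fun p => C p.1 p.2 *ᵥ fun n => x (.inr (.inl (p, n))),
    fun p => S.sigma * x (.inr (.inr p)))

instance (n : ℕ) : IsProbabilityMeasure (stdComplexGaussian n) := by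
  unfold stdComplexGaussian; infer_instance

lemma measurable_mulVec_const {m n : Type*} [Fintype n] (A : Matrix m n ℂ) :
    Measurable fun q : n → ℂ => A *ᵥ q :=
  measurable_pi_lambda _ fun i => by simp only [Matrix.mulVec, dotProduct]; fun_prop

lemma measurePreserving_primitivesOfSource (S : Network M N K τp)
    (C : Fin M → Fin K → Matrix (Fin N) (Fin N) ℂ) :
    MeasurePreserving (primitivesOfSource S C) (Measure.pi sourceLaw)
      ((Measure.pi fun _ => phaseLaw).prod
        ((Measure.pi fun p : Fin M × Fin K =>
            (stdComplexGaussian N).map fun q => C p.1 p.2 *ᵥ q).prod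
          (Measure.pi fun _ => complexGaussian (S.sigma ^ 2).toNNReal))) := by
  have := isCircular_phaseLaw.isProbabilityMeasure
  have hC : ∀ p : Fin M × Fin K, Measurable fun q : Fin N → ℂ => C p.1 p.2 *ᵥ q :=
    fun p => measurable_mulVec_const _
  have (p : Fin M × Fin K) :
      IsProbabilityMeasure ((stdComplexGaussian N).map fun q => C p.1 p.2 *ᵥ q) :=
    Measure.isProbabilityMeasure_map (hC p).aemeasurable
  have hcurry : MeasurePreserving (MeasurableEquiv.curry (Fin M × Fin K) (Fin N) ℂ)
      (Measure.pi fun _ => complexGaussian 1) (Measure.pi fun _ => stdComplexGaussian N) := by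
    refine ⟨MeasurableEquiv.measurable _, ?_⟩
    have h := Measure.infinitePi_map_curry
      (fun (_ : Fin M × Fin K) (_ : Fin N) => complexGaussian 1)
    simp only [Measure.infinitePi_eq_pi] at h
    exact h
  have hnlos := (measurePreserving_pi (fun _ : Fin M × Fin K => stdComplexGaussian N) _
    fun p => ⟨hC p, rfl⟩).comp hcurry
  have hnoise := measurePreserving_pi
    (fun _ : Fin M × Fin N × Fin τp => complexGaussian 1) _
    fun _ => ⟨by fun_prop, (complexGaussian_eq_map S.sigma S.sigma_pos).symm⟩
  have h2 := measurePreserving_sumPiEquivProdPi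
    (fun _ : ((Fin M × Fin K) × Fin N) ⊕ (Fin M × Fin N × Fin τp) => complexGaussian 1)
  have h1 := measurePreserving_sumPiEquivProdPi (sourceLaw (M := M) (N := N) (K := K) (τp := τp))
  exact ((MeasurePreserving.id _).prod ((hnlos.prod hnoise).comp h2)).comp h1

variable {S : Network M N K τp} {Ω : Type*} [MeasurableSpace Ω] {P : Measure Ω}
  [IsProbabilityMeasure P] (B : Block S Ω P)

/-- The phase factors `e^{jθ_mk}`, NLoS components and noise entries of a block. -/
def Block.primitives (ω : Ω) : Primitives M N K τp :=
  (fun p => Complex.exp (Complex.I * B.phase p.1 p.2 ω), fun p => B.nlos p.1 p.2 ω,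
    fun p => B.noise p.1 p.2.1 p.2.2 ω)

/-- In law, a coherence block is generated by independent circular variables. Only the joint law is
reproduced: the Gaussians behind the NLoS components need not exist on the given probability space,
as the square factors may be singular. -/
theorem Block.exists_identDistrib_primitives :
    ∃ C, Factors S C ∧ IdentDistrib B.primitives (primitivesOfSource S C) P
      (Measure.pi sourceLaw) := by
  choose C hC hlaw using B.nlos_gaussian
  refine ⟨C, hC, ?_⟩
  have hexp : Measurable fun θ : ℝ => Complex.exp (Complex.I * θ) := by fun_prop
  have hu : HasLaw (fun ω (p : Fin M × Fin K) => Complex.exp (Complex.I * B.phase p.1 p.2 ω))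
      (Measure.pi fun _ => phaseLaw) P := by
    refine iIndepFun.hasLaw_pi (fun p => ?_) (B.phase_indep.comp
      (fun _ (θ : ℝ) => Complex.exp (Complex.I * θ)) fun _ => hexp)
    have hp := B.phase_uniform p.1 p.2
    have hpm : AEMeasurable (B.phase p.1 p.2) P :=
      hp.aemeasurable (by rw [volume_Icc_pi]; simp [Real.pi_pos])
        (by rw [volume_Icc_pi]; exact ENNReal.ofReal_ne_top)
    refine ⟨hexp.comp_aemeasurable hpm, ?_⟩
    exact (AEMeasurable.map_map_of_aemeasurable hexp.aemeasurable hpm).symm.trans (by rw [hp]; rfl)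
  have hh := iIndepFun.hasLaw_pi (fun p : Fin M × Fin K => hlaw p.1 p.2) B.nlos_indep
  have hn := iIndepFun.hasLaw_pi
    (fun p : Fin M × Fin N × Fin τp => B.noise_gaussian p.1 p.2.1 p.2.2) B.noise_indep
  have hhn := IndepFun.hasLaw_prod hh hn <| B.nlos_indep_noise.comp
    (φ := fun (h : Fin M → Fin K → Fin N → ℂ) (p : Fin M × Fin K) => h p.1 p.2)
    (ψ := fun (z : Fin M → Fin N → Fin τp → ℂ) (p : Fin M × Fin N × Fin τp) => z p.1 p.2.1 p.2.2) (by fun_prop) (by fun_prop)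
  have h := IndepFun.hasLaw_prod hu hhn <| B.phase_indep_nlos_noise.comp
    (φ := fun (θ : Fin M → Fin K → ℝ) (p : Fin M × Fin K) => Complex.exp (Complex.I * θ p.1 p.2))
    (ψ := fun (z : (Fin M → Fin K → Fin N → ℂ) × (Fin M → Fin N → Fin τp → ℂ)) =>
      ((fun p => z.1 p.1 p.2 : Fin M × Fin K → Fin N → ℂ),
      (fun p => z.2 p.1 p.2.1 p.2.2 : Fin M × Fin N × Fin τp → ℂ)))
    (by fun_prop) (by fun_prop)
  have hm := measurePreserving_primitivesOfSource S C
  exact ⟨h.aemeasurable, hm.measurable.aemeasurable, h.map_eq.trans hm.map_eq.symm⟩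

end Source

/-! ### Channels and estimates as linear images of the independent sources -/

section Linear

variable {M N K τp : ℕ} (S : Network M N K τp)
  (C : Fin M → Fin K → Matrix (Fin N) (Fin N) ℂ)

/-- Matrix of the map from the phase factors to the LoS part of `g_l`. -/
def losCols (l : Fin K) : Matrix (Idx M N) (Fin M × Fin K) ℂ :=
  Matrix.of fun i p => if p = (i.2, l) then S.los i.2 l i.1 else 0

/-- Matrix of the map from the NLoS Gaussians to the NLoS part of `g_l`. -/
def nlosCols (l : Fin K) : Matrix (Idx M N) ((Fin M × Fin K) × Fin N) ℂ :=
  Matrix.of fun i p => if p.1 = (i.2, l) then C i.2 l i.1 p.2 else 0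

/-- Matrix of the map from the noise Gaussians to the stacked noise despread with the pilot of
UE `k`. -/
def noiseCols (k : Fin K) : Matrix (Idx M N) (Fin M × Fin N × Fin τp) ℂ :=
  Matrix.of fun i p => if p.1 = i.2 then
    (if p.2.1 = i.1 then S.sigma * star (S.pilot (S.pilotIndex k) p.2.2) else 0) else 0

/-- Matrix of the map from the Gaussians to `y_k^p - ȳ_k^p`. -/
def innovationMatrix (k : Fin K) :
    Matrix (Idx M N) (((Fin M × Fin K) × Fin N) ⊕ (Fin M × Fin N × Fin τp)) ℂ :=
  Matrix.fromCols (∑ l ∈ S.copilot k, ((Real.sqrt (S.power l) * τp : ℝ) : ℂ) • nlosCols C l)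
    (noiseCols S k)

/-- Matrix of the map from the generating variables to the channel `g_l`. -/
def channelMatrix (l : Fin K) : Matrix (Idx M N) (SourceIdx M N K τp) ℂ :=
  Matrix.fromCols (losCols S l) (Matrix.fromCols (nlosCols C l) 0)

/-- Matrix of the map from the generating variables to the estimate `ĝ_k`. -/
def estimateMatrix (k : Fin K) : Matrix (Idx M N) (SourceIdx M N K τp) ℂ :=
  Matrix.fromCols (losCols S k)
    ((Real.sqrt (S.power k) : ℂ) • (S.corrAll k * (S.psi k)⁻¹ * innovationMatrix S C k))

/-- The channel `g_l` as a function of the phase factors, NLoS components and noise. -/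
def channelOf (l : Fin K) (t : Primitives M N K τp) : Idx M N → ℂ :=
  fun i => t.1 (i.2, l) * S.los i.2 l i.1 + t.2.1 (i.2, l) i.1

/-- The innovation `y_k^p - ȳ_k^p` after despreading, as a function of the phase factors, NLoS
components and noise. -/
def innovationOf (k : Fin K) (t : Primitives M N K τp) : Idx M N → ℂ :=
  fun i => ∑ l ∈ S.copilot k, ((Real.sqrt (S.power l) * τp : ℝ) : ℂ) * t.2.1 (i.2, l) i.1
    + ∑ j, t.2.2 (i.2, i.1, j) * star (S.pilot (S.pilotIndex k) j)

/-- The estimate `ĝ_k` as a function of the phase factors, NLoS components and noise. -/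
def estimateOf (k : Fin K) (t : Primitives M N K τp) : Idx M N → ℂ :=
  (fun i => t.1 (i.2, k) * S.los i.2 k i.1)
    + (Real.sqrt (S.power k) : ℂ) • ((S.corrAll k * (S.psi k)⁻¹) *ᵥ innovationOf S k t)

lemma measurable_channelOf (l : Fin K) : Measurable (channelOf S l) := by
  refine measurable_pi_lambda _ fun i => ?_
  unfold channelOf; fun_prop

lemma measurable_innovationOf (k : Fin K) : Measurable (innovationOf S k) := by
  refine measurable_pi_lambda _ fun i => ?_
  unfold innovationOf; fun_prop

lemma measurable_estimateOf (k : Fin K) : Measurable (estimateOf S k) := by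
  have h := (measurable_mulVec_const (S.corrAll k * (S.psi k)⁻¹)).comp
    (measurable_innovationOf S k)
  exact Measurable.add (measurable_pi_lambda _ fun i => by fun_prop)
    (h.const_smul (Real.sqrt (S.power k) : ℂ))

lemma losCols_mulVec (l : Fin K) (y : Fin M × Fin K → ℂ) (i : Idx M N) :
    (losCols S l *ᵥ y) i = y (i.2, l) * S.los i.2 l i.1 := by
  simp [losCols, Matrix.mulVec, dotProduct, mul_comm]

lemma nlosCols_mulVec (l : Fin K) (y : (Fin M × Fin K) × Fin N → ℂ) (i : Idx M N) :
    (nlosCols C l *ᵥ y) i = (C i.2 l *ᵥ fun n => y ((i.2, l), n)) i.1 := by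
  simp [nlosCols, Matrix.mulVec, dotProduct, Fintype.sum_prod_type_right]

lemma noiseCols_mulVec (k : Fin K) (y : Fin M × Fin N × Fin τp → ℂ) (i : Idx M N) :
    (noiseCols S k *ᵥ y) i =
      ∑ j, S.sigma * y (i.2, i.1, j) * star (S.pilot (S.pilotIndex k) j) := by
  simp only [noiseCols, Matrix.mulVec, dotProduct, Fintype.sum_prod_type, Matrix.of_apply]
  simp [Finset.sum_ite_irrel, mul_right_comm]

lemma channelOf_primitivesOfSource (l : Fin K) (x : SourceIdx M N K τp → ℂ) :
    channelOf S l (primitivesOfSource S C x) = channelMatrix S C l *ᵥ x := by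
  ext i
  simp only [channelMatrix, Matrix.fromCols_mulVec, Pi.add_apply, losCols_mulVec,
    nlosCols_mulVec, Matrix.zero_mulVec, add_zero]
  rfl

lemma innovationOf_primitivesOfSource (k : Fin K) (x : SourceIdx M N K τp → ℂ) :
    innovationOf S k (primitivesOfSource S C x) =
      innovationMatrix S C k *ᵥ (x ∘ Sum.inr) := by
  ext i
  simp only [innovationMatrix, Matrix.fromCols_mulVec, Pi.add_apply, noiseCols_mulVec,
    Matrix.sum_mulVec, Finset.sum_apply, Matrix.smul_mulVec, Pi.smul_apply, nlosCols_mulVec,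
    smul_eq_mul]
  rfl

lemma estimateOf_primitivesOfSource (k : Fin K) (x : SourceIdx M N K τp → ℂ) :
    estimateOf S k (primitivesOfSource S C x) = estimateMatrix S C k *ᵥ x := by
  rw [estimateOf, innovationOf_primitivesOfSource, estimateMatrix, Matrix.fromCols_mulVec,
    Matrix.smul_mulVec, Matrix.mulVec_mulVec]
  congr 1
  ext i
  rw [losCols_mulVec]
  rfl

variable {S} {Ω : Type*} [MeasurableSpace Ω] {P : Measure Ω} (B : Block S Ω P)

lemma Block.channel_eq_channelOf (l : Fin K) (ω : Ω) :
    B.channel l ω = channelOf S l (B.primitives ω) := rfl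

/-- Despreading with the pilot of UE `k` keeps exactly the UEs of `𝒫_k`, with gain `τp`. -/
lemma pilot_dotProduct_star (S : Network M N K τp) (l k : Fin K) :
    S.pilot (S.pilotIndex l) ⬝ᵥ star (S.pilot (S.pilotIndex k)) =
      if l ∈ S.copilot k then (τp : ℂ) else 0 := by
  simp only [Network.copilot, Finset.mem_filter, Finset.mem_univ, true_and]
  split_ifs with h
  · have h1 := S.pilot_norm_sq (S.pilotIndex k)
    rw [h, dotProduct]
    simp only [Pi.star_apply, Complex.star_def, Complex.mul_conj']
    exact_mod_cast h1
  · rw [dotProduct_comm]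
    exact S.pilot_orthogonal _ _ (Ne.symm h)

lemma Block.despreadAP_apply (m : Fin M) (k : Fin K) (ω : Ω) (n : Fin N) :
    B.despreadAP m k ω n =
      ∑ l ∈ S.copilot k, ((Real.sqrt (S.power l) * τp : ℝ) : ℂ) * B.channelAP m l ω n
        + ∑ j, B.noise m n j ω * star (S.pilot (S.pilotIndex k) j) := by
  rw [Block.despreadAP, Block.receivedPilot, Matrix.add_mulVec, Matrix.sum_mulVec, Pi.add_apply,
    Finset.sum_apply]
  congr 1
  simp only [Matrix.smul_mulVec, Pi.smul_apply, Matrix.vecMulVec_mulVec,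
    MulOpposite.smul_eq_mul_unop, MulOpposite.unop_op, pilot_dotProduct_star, smul_eq_mul, mul_ite, mul_zero]
  rw [← Finset.sum_filter, Finset.filter_mem_eq_inter, Finset.univ_inter]
  refine Finset.sum_congr rfl fun l _ => ?_
  push_cast; ring

lemma Block.innovation_eq_innovationOf (k : Fin K) (ω : Ω) :
    B.innovation k ω = innovationOf S k (B.primitives ω) := by
  ext i
  simp only [Block.innovation, B.despreadAP_apply, Block.despreadMeanAP, Block.channelAP,
    Finset.sum_apply, Pi.add_apply, Pi.smul_apply, smul_eq_mul, mul_add, Finset.sum_add_distrib,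
    innovationOf, Block.primitives]
  ring

lemma Block.estimate_eq_estimateOf (k : Fin K) (ω : Ω) :
    B.estimate k ω = estimateOf S k (B.primitives ω) := by
  rw [Block.estimate, B.innovation_eq_innovationOf]
  rfl

end Linear

/-! ### Second-order statistics -/

section Gram

variable {M N K τp : ℕ} (S : Network M N K τp)
  {C : Fin M → Fin K → Matrix (Fin N) (Fin N) ℂ}

lemma losCols_mul_conjTranspose (l l' : Fin K) :
    losCols S l * (losCols S l')ᴴ = if l = l' then S.losGram l else 0 := by
  ext ⟨n, m⟩ ⟨n', m'⟩
  simp only [losCols, Matrix.mul_apply, Matrix.conjTranspose_apply, Matrix.of_apply]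
  split_ifs with h
  · subst h
    by_cases hm : m = m'
    · subst hm
      simp [Network.losGram, Network.losGramAP, Matrix.vecMulVec_apply]
    · simp [Network.losGram, Matrix.blockDiagonal_apply, hm]
  · simp [h]

lemma nlosCols_mul_conjTranspose (hC : Factors S C) (l l' : Fin K) :
    nlosCols C l * (nlosCols C l')ᴴ = if l = l' then S.corrAll l else 0 := by
  ext ⟨n, m⟩ ⟨n', m'⟩
  simp only [nlosCols, Matrix.mul_apply, Matrix.conjTranspose_apply, Matrix.of_apply]
  rw [Fintype.sum_prod_type]
  split_ifs with h
  · subst h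
    by_cases hm : m = m'
    · subst hm
      simp [Network.corrAll, ← hC m l, Matrix.mul_apply, Finset.sum_ite_irrel]
    · simp [Network.corrAll, Matrix.blockDiagonal_apply, hm, Finset.sum_ite_irrel]
  · simp [h, Finset.sum_ite_irrel]

lemma noiseCols_mul_conjTranspose (k : Fin K) :
    noiseCols S k * (noiseCols S k)ᴴ = ((τp * S.sigma ^ 2 : ℝ) : ℂ) • (1 : Matrix _ _ ℂ) := by
  have hp : ∑ j, star (S.pilot (S.pilotIndex k) j) * S.pilot (S.pilotIndex k) j = (τp : ℂ) := by
    simp only [Complex.star_def, Complex.conj_mul']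
    exact_mod_cast S.pilot_norm_sq (S.pilotIndex k)
  ext ⟨n, m⟩ ⟨n', m'⟩
  simp only [noiseCols, Matrix.mul_apply, Matrix.conjTranspose_apply, Matrix.of_apply,
    Fintype.sum_prod_type, Matrix.smul_apply, Matrix.one_apply, Prod.mk.injEq]
  by_cases hm : m = m'
  · subst hm
    by_cases hn : n = n'
    · subst hn
      simp only [and_self, if_true, smul_eq_mul, mul_one]
      push_cast
      rw [← hp, Finset.sum_mul]
      simp [Finset.sum_ite_irrel]
      exact Finset.sum_congr rfl fun j _ => by ring
    · simp [Finset.sum_ite_irrel, hn]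
  · simp [Finset.sum_ite_irrel, hm]

lemma conjTranspose_fromCols {m n₁ n₂ : Type*} (A : Matrix m n₁ ℂ) (B : Matrix m n₂ ℂ) :
    (Matrix.fromCols A B)ᴴ = Matrix.fromRows Aᴴ Bᴴ := by
  ext i j; rcases i with i | i <;> rfl

lemma isHermitian_corrAll (k : Fin K) : (S.corrAll k).IsHermitian := by
  rw [Matrix.IsHermitian, Network.corrAll, Matrix.blockDiagonal_conjTranspose]
  congr 1; ext1 m
  exact (S.corr_posSemidef m k).isHermitian

lemma psi_eq (k : Fin K) : S.psi k = ∑ l ∈ S.copilot k, ((S.power l * τp : ℝ) : ℂ) • S.corrAll l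
    + ((S.sigma ^ 2 : ℝ) : ℂ) • (1 : Matrix _ _ ℂ) := by
  ext ⟨n, m⟩ ⟨n', m'⟩
  by_cases h : m = m'
  · subst h
    simp [Network.psi, Network.psiAP, Network.corrAll, Matrix.sum_apply, Matrix.one_apply]
  · simp [Network.psi, Network.corrAll, Matrix.sum_apply, Matrix.blockDiagonal_apply, h]

lemma posDef_psi (hC : Factors S C) (k : Fin K) : (S.psi k).PosDef := by
  have hcorr (l : Fin K) : (S.corrAll l).PosSemidef := by
    have h := Matrix.posSemidef_self_mul_conjTranspose (nlosCols C l)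
    rwa [nlosCols_mul_conjTranspose S hC, if_pos rfl] at h
  rw [psi_eq]
  refine Matrix.PosDef.posSemidef_add (Matrix.posSemidef_sum _ fun l _ => ?_) ?_
  · exact (hcorr l).smul (by exact_mod_cast mul_nonneg (S.power_nonneg l) (Nat.cast_nonneg _))
  · exact Matrix.PosDef.one.smul (by exact_mod_cast pow_pos S.sigma_pos 2)

/-- The innovation has covariance `τp Ψ_k`. -/
lemma innovationMatrix_mul_conjTranspose (hC : Factors S C) (k : Fin K) :
    innovationMatrix S C k * (innovationMatrix S C k)ᴴ = (τp : ℂ) • S.psi k := by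
  rw [innovationMatrix, conjTranspose_fromCols, Matrix.fromCols_mul_fromRows,
    noiseCols_mul_conjTranspose, psi_eq, smul_add, Matrix.conjTranspose_sum, Matrix.sum_mul,
    Finset.smul_sum, smul_smul]
  congr 1
  · refine Finset.sum_congr rfl fun l hl => ?_
    simp only [Matrix.conjTranspose_smul, Matrix.smul_mul, Matrix.mul_sum, Matrix.mul_smul,
      nlosCols_mul_conjTranspose S hC, smul_ite, smul_zero, Finset.sum_ite_eq, hl, if_true,
      smul_smul, Complex.star_def, Complex.conj_ofReal]
    congr 1
    rw [← Complex.ofReal_mul]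
    rw [mul_mul_mul_comm, Real.mul_self_sqrt (S.power_nonneg l)]
    push_cast; ring
  · push_cast; rfl

/-- The cross-covariance of the NLoS channel of UE `l` and the innovation of UE `k`. -/
lemma nlosCols_mul_innovationMatrix (hC : Factors S C) (l k : Fin K) :
    (Matrix.fromCols (nlosCols C l) 0 :
        Matrix (Idx M N) (((Fin M × Fin K) × Fin N) ⊕ (Fin M × Fin N × Fin τp)) ℂ) *
        (innovationMatrix S C k)ᴴ =
      if l ∈ S.copilot k then ((Real.sqrt (S.power l) * τp : ℝ) : ℂ) • S.corrAll l else 0 := by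
  rw [innovationMatrix, conjTranspose_fromCols, Matrix.fromCols_mul_fromRows,
    Matrix.conjTranspose_sum, Matrix.mul_sum]
  simp only [Matrix.conjTranspose_smul, Matrix.mul_smul, nlosCols_mul_conjTranspose S hC,
    smul_ite, smul_zero, Finset.sum_ite_eq, Complex.star_def, Complex.conj_ofReal,
    Matrix.zero_mul, add_zero]

lemma channelMatrix_mul_conjTranspose (hC : Factors S C) (l : Fin K) :
    channelMatrix S C l * (channelMatrix S C l)ᴴ = S.losGram l + S.corrAll l := by
  rw [channelMatrix, conjTranspose_fromCols, Matrix.fromCols_mul_fromRows,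
    conjTranspose_fromCols, Matrix.fromCols_mul_fromRows, losCols_mul_conjTranspose,
    nlosCols_mul_conjTranspose S hC, if_pos rfl, if_pos rfl, Matrix.zero_mul, add_zero]

/-- The adjoint of the estimation filter `Ř_k Ψ_k⁻¹`. -/
lemma conjTranspose_filter (hC : Factors S C) (k : Fin K) :
    (S.corrAll k * (S.psi k)⁻¹)ᴴ = (S.psi k)⁻¹ * S.corrAll k := by
  rw [Matrix.conjTranspose_mul, (posDef_psi S hC k).isHermitian.inv, isHermitian_corrAll]

lemma estimateMatrix_mul_conjTranspose (hC : Factors S C) (k : Fin K) :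
    estimateMatrix S C k * (estimateMatrix S C k)ᴴ = S.totalCorr k := by
  have hu := (Matrix.isUnit_iff_isUnit_det _).1 (posDef_psi S hC k).isUnit
  rw [estimateMatrix, conjTranspose_fromCols, Matrix.fromCols_mul_fromRows,
    losCols_mul_conjTranspose, if_pos rfl, Network.totalCorr]
  congr 1
  rw [Matrix.conjTranspose_smul, Matrix.smul_mul, Matrix.mul_smul, Matrix.conjTranspose_mul,
    Matrix.mul_assoc, ← Matrix.mul_assoc (innovationMatrix S C k),
    innovationMatrix_mul_conjTranspose S hC, conjTranspose_filter S hC, Matrix.smul_mul,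
    Matrix.mul_smul, ← Matrix.mul_assoc (S.psi k), Matrix.mul_nonsing_inv _ hu, Matrix.one_mul,
    smul_smul, smul_smul]
  congr 1
  rw [Complex.star_def, Complex.conj_ofReal, ← Complex.ofReal_mul,
    Real.mul_self_sqrt (S.power_nonneg k)]
  push_cast; rfl

lemma channelMatrix_mul_estimateMatrix (hC : Factors S C) (l k : Fin K) :
    channelMatrix S C l * (estimateMatrix S C k)ᴴ = (if l = k then S.losGram k else 0)
      + if l ∈ S.copilot k then ((Real.sqrt (S.power k) * Real.sqrt (S.power l) * τp : ℝ) : ℂ) •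
          (S.corrAll l * (S.psi k)⁻¹ * S.corrAll k) else 0 := by
  rw [channelMatrix, estimateMatrix, conjTranspose_fromCols, Matrix.fromCols_mul_fromRows,
    losCols_mul_conjTranspose]
  congr 1
  · split_ifs with h
    · rw [h]
    · rfl
  rw [Matrix.conjTranspose_smul, Matrix.mul_smul, Matrix.conjTranspose_mul, ← Matrix.mul_assoc,
    nlosCols_mul_innovationMatrix S hC, conjTranspose_filter S hC]
  split_ifs
  · rw [Matrix.smul_mul, smul_smul, Matrix.mul_assoc]
    congr 1
    simp only [Complex.star_def, Complex.conj_ofReal]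
    push_cast; ring
  · simp

end Gram

/-! ### The closed form -/

section ClosedForm

variable {M N K τp : ℕ} (S : Network M N K τp) (W : Matrix (Idx M N) (Idx M N) ℂ)
  {C : Fin M → Fin K → Matrix (Fin N) (Fin N) ℂ}

/-- The form `ḡ_{m₁k}ᴴ W_{m₁m₂} ḡ_{m₂k}`, in terms of which every LoS trace is expressed. -/
def losForm (k : Fin K) (m₁ m₂ : Fin M) : ℂ :=
  star (S.los m₁ k) ⬝ᵥ subBlock W m₁ m₂ *ᵥ S.los m₂ k

lemma losCols_conjTranspose_mul_mul (l k : Fin K) (p q : Fin M × Fin K) :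
    ((losCols S l)ᴴ * W * losCols S k) p q = if p.2 = l then (if q.2 = k then
      star (S.los p.1 l) ⬝ᵥ subBlock W p.1 q.1 *ᵥ S.los q.1 k else 0) else 0 := by
  obtain ⟨m, a⟩ := p
  obtain ⟨m', b⟩ := q
  rw [Matrix.mul_assoc]
  simp only [Matrix.mul_apply, Matrix.conjTranspose_apply, losCols, Matrix.of_apply,
    Fintype.sum_prod_type_right, dotProduct, Matrix.mulVec, subBlock, Matrix.submatrix_apply,
    Prod.mk.injEq, Pi.star_apply]
  by_cases ha : a = l
  · by_cases hb : b = k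
    · simp [ha, hb, apply_ite (starRingEnd ℂ), Finset.sum_ite_irrel]
    · simp [hb]
  · simp [ha]

lemma trace_mul_losGram (k : Fin K) :
    (W * S.losGram k).trace = ∑ m, losForm S W k m m := by
  have h : S.losGram k = losCols S k * (losCols S k)ᴴ := by
    rw [losCols_mul_conjTranspose, if_pos rfl]
  rw [h, ← Matrix.mul_assoc, Matrix.trace_mul_comm, ← Matrix.mul_assoc, Matrix.trace]
  simp only [Matrix.diag_apply, losCols_conjTranspose_mul_mul, Fintype.sum_prod_type]
  simp [losForm]

lemma trace_mul_conjTranspose_self {m n : Type*} [Fintype m] [Fintype n] (Q : Matrix m n ℂ) :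
    (Q * Qᴴ).trace = ∑ a, ∑ b, ((‖Q a b‖ ^ 2 : ℝ) : ℂ) := by
  simp [Matrix.trace, Matrix.mul_apply, Complex.mul_conj']

lemma trace_losGram_mul_losGram (k : Fin K) :
    (Wᴴ * S.losGram k * W * S.losGram k).trace =
      ∑ m₁, ∑ m₂, ((‖losForm S W k m₂ m₁‖ ^ 2 : ℝ) : ℂ) := by
  have h : S.losGram k = losCols S k * (losCols S k)ᴴ := by
    rw [losCols_mul_conjTranspose, if_pos rfl]
  have e : (Wᴴ * S.losGram k * W * S.losGram k).trace =
      (((losCols S k)ᴴ * W * losCols S k) * ((losCols S k)ᴴ * W * losCols S k)ᴴ).trace := by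
    rw [h]
    simp only [Matrix.conjTranspose_mul, Matrix.conjTranspose_conjTranspose]
    rw [Matrix.trace_mul_comm (_ * W * _)]
    simp only [← Matrix.mul_assoc]
    rw [Matrix.trace_mul_comm _ (losCols S k)ᴴ]
    simp only [← Matrix.mul_assoc]
  rw [e, trace_mul_conjTranspose_self, Finset.sum_comm]
  simp only [losCols_conjTranspose_mul_mul, Fintype.sum_prod_type]
  refine Finset.sum_congr rfl fun m₁ _ => ?_
  rw [Finset.sum_eq_single k (fun b _ hb => by simp [hb]) (by simp)]
  refine Finset.sum_congr rfl fun m₂ _ => ?_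
  rw [Finset.sum_eq_single k (fun b _ hb => by simp [hb]) (by simp)]
  simp [losForm]

lemma trace_mul_vecMulVec_mul_vecMulVec {n : Type*} [Fintype n] (X Y : Matrix n n ℂ)
    (u v w z : n → ℂ) :
    (X * Matrix.vecMulVec u v * Y * Matrix.vecMulVec w z).trace =
      (z ⬝ᵥ X *ᵥ u) * (v ⬝ᵥ Y *ᵥ w) := by
  rw [Matrix.mul_assoc _ Y, Matrix.mul_vecMulVec, Matrix.mul_vecMulVec,
    Matrix.vecMulVec_mul_vecMulVec, Matrix.trace_vecMulVec, dotProduct_smul, smul_eq_mul,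
    dotProduct_comm z, mul_comm]

lemma star_dotProduct_conjTranspose_mulVec {n : Type*} [Fintype n] (X : Matrix n n ℂ)
    (u v : n → ℂ) : star u ⬝ᵥ Xᴴ *ᵥ v = star (star v ⬝ᵥ X *ᵥ u) := by
  rw [Matrix.dotProduct_mulVec, Matrix.vecMul_conjTranspose, star_star, Matrix.star_dotProduct]

lemma isHermitian_losGram (k : Fin K) : (S.losGram k).IsHermitian := by
  have h := Matrix.isHermitian_mul_conjTranspose_self (losCols S k)
  rwa [losCols_mul_conjTranspose, if_pos rfl] at h

lemma star_trace_conjTranspose_mul {n : Type*} [Fintype n] (X Y : Matrix n n ℂ)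
    (hY : Y.IsHermitian) : star (Xᴴ * Y).trace = (X * Y).trace := by
  rw [← Matrix.trace_conjTranspose, Matrix.conjTranspose_mul, Matrix.conjTranspose_conjTranspose,
    hY, Matrix.trace_mul_comm]

lemma isHermitian_corrAll_mul_inv_mul (hC : Factors S C) (k : Fin K) :
    (S.corrAll k * (S.psi k)⁻¹ * S.corrAll k).IsHermitian := by
  have := Matrix.isHermitian_mul_mul_conjTranspose (S.corrAll k) (posDef_psi S hC k).isHermitian.inv
  rwa [isHermitian_corrAll S k] at this

/-- `ω_k` is what `|tr(Wᴴ R̄_k)|²` contains beyond `ε_kk`, less the correction for the constant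
modulus of the phase factors. -/
theorem omega_eq (k : Fin K) (hC : Factors S C) : S.omega W k =
    ((‖(Wᴴ * S.totalCorr k).trace‖ ^ 2 : ℝ) : ℂ) - (S.eps W k k : ℂ)
      - ∑ m, ((‖losForm S W k m m‖ ^ 2 : ℝ) : ℂ) := by
  set g := (Wᴴ * S.losGram k).trace with hg
  set r := (Wᴴ * S.corrAll k * (S.psi k)⁻¹ * S.corrAll k).trace with hr
  set b := losForm S W k with hb
  have hr' : star r = (W * S.corrAll k * (S.psi k)⁻¹ * S.corrAll k).trace := by
    have := star_trace_conjTranspose_mul W _ (isHermitian_corrAll_mul_inv_mul S hC k)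
    simpa only [← Matrix.mul_assoc] using this
  have hg' : star g = (W * S.losGram k).trace :=
    star_trace_conjTranspose_mul W _ (isHermitian_losGram S k)
  have hgb : star g = ∑ m, b m m := hg'.trans (trace_mul_losGram S W k)
  have hgb' : g = ∑ m, star (b m m) := by rw [← star_star g, hgb, star_sum]
  have hT : (Wᴴ * S.totalCorr k).trace = g + ((S.power k * τp : ℝ) : ℂ) * r := by
    rw [Network.totalCorr, Matrix.mul_add, Matrix.trace_add, Matrix.mul_smul, Matrix.trace_smul,
      smul_eq_mul, hg, hr]
    simp only [← Matrix.mul_assoc]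
  have h1 (m₁ m₂ : Fin M) : ((subBlock W m₁ m₁)ᴴ * S.losCross m₁ m₂ k * subBlock W m₂ m₂
      * (S.losCross m₁ m₂ k)ᴴ).trace = star (b m₁ m₁) * b m₂ m₂ := by
    rw [Network.losCross, Matrix.conjTranspose_vecMulVec, star_star,
      trace_mul_vecMulVec_mul_vecMulVec, star_dotProduct_conjTranspose_mulVec]
    rfl
  have h2 (m₁ m₂ : Fin M) : ((subBlock W m₂ m₁)ᴴ * S.losGramAP m₂ k * subBlock W m₂ m₁
      * S.losGramAP m₁ k).trace = ((‖b m₂ m₁‖ ^ 2 : ℝ) : ℂ) := by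
    rw [Network.losGramAP, Network.losGramAP,
      trace_mul_vecMulVec_mul_vecMulVec, star_dotProduct_conjTranspose_mulVec, Complex.star_def,
      Complex.conj_mul']
    push_cast; rfl
  have hsplit (f : Fin M → Fin M → ℂ) : ∑ m₁, ∑ m₂, f m₁ m₂ =
      ∑ m₁, ∑ m₂ ∈ Finset.univ.filter (fun m₂ => m₁ ≠ m₂), f m₁ m₂ + ∑ m, f m m := by
    rw [← Finset.sum_add_distrib]
    refine Finset.sum_congr rfl fun m _ => ?_
    rw [← Finset.sum_filter_add_sum_filter_not Finset.univ (fun m₂ => m ≠ m₂)]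
    simp [Finset.filter_eq]
  have hgg : g * star g = ∑ m₁, ∑ m₂ ∈ Finset.univ.filter (fun m₂ => m₁ ≠ m₂),
      star (b m₁ m₁) * b m₂ m₂ + ∑ m, ((‖b m m‖ ^ 2 : ℝ) : ℂ) := by
    rw [hgb, hgb', Finset.sum_mul_sum, hsplit]
    congr 1
    refine Finset.sum_congr rfl fun m _ => ?_
    rw [Complex.star_def, Complex.conj_mul']; push_cast; rfl
  -- splitting the double sum in `tr(Wᴴ Ḡ W Ḡ)` cancels the `|b m₂ m₁|²` terms of `ω_k`, which
  -- leaves the cross terms and the off-diagonal part of `g * star g`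
  rw [Network.omega, ← hr, ← hr', ← hg, ← hg', trace_losGram_mul_losGram, hsplit, hT, Network.eps,
    ← hr]
  simp only [h1, h2, Finset.sum_add_distrib, Complex.ofReal_mul,
    Complex.ofReal_pow, ← Complex.mul_conj', map_add, map_mul, Complex.conj_ofReal] at hgg ⊢
  simp only [Complex.star_def, Complex.ofReal_natCast] at hgg ⊢
  linear_combination -hgg

variable (C)

/-- The matrix of `v_kᴴ g_l` as a quadratic form in the generating variables. -/
def uatfMatrix (k l : Fin K) : Matrix (SourceIdx M N K τp) (SourceIdx M N K τp) ℂ :=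
  (W * estimateMatrix S C k)ᴴ * channelMatrix S C l

variable {C}

lemma trace_uatfMatrix (k l : Fin K) :
    (uatfMatrix S W C k l).trace =
      (Wᴴ * (channelMatrix S C l * (estimateMatrix S C k)ᴴ)).trace := by
  rw [uatfMatrix, Matrix.conjTranspose_mul, Matrix.mul_assoc, Matrix.trace_mul_comm,
    Matrix.mul_assoc]

lemma trace_uatfMatrix_self (hC : Factors S C) (k : Fin K) :
    (uatfMatrix S W C k k).trace = (Wᴴ * S.totalCorr k).trace := by
  rw [trace_uatfMatrix, channelMatrix_mul_estimateMatrix S hC, if_pos rfl,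
    if_pos (by simp [Network.copilot]), Real.mul_self_sqrt (S.power_nonneg k)]
  rfl

lemma norm_sq_trace_uatfMatrix (hC : Factors S C) {k l : Fin K} (hlk : l ≠ k) :
    ‖(uatfMatrix S W C k l).trace‖ ^ 2 = if l ∈ S.copilot k then S.eps W k l else 0 := by
  rw [trace_uatfMatrix, channelMatrix_mul_estimateMatrix S hC, if_neg hlk, zero_add]
  split_ifs
  · rw [Matrix.mul_smul, Matrix.trace_smul, norm_smul, mul_pow, Complex.norm_real, Real.norm_eq_abs,
      sq_abs, mul_pow, mul_pow, Real.sq_sqrt (S.power_nonneg k), Real.sq_sqrt (S.power_nonneg l),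
      Network.eps]
    simp only [← Matrix.mul_assoc]
  · simp

/-- The squared Frobenius norm of the quadratic form is `μ_kl`. -/
lemma sum_norm_sq_uatfMatrix (hC : Factors S C) (k l : Fin K) :
    ∑ a, ∑ b, ((‖uatfMatrix S W C k l a b‖ ^ 2 : ℝ) : ℂ) = S.mu W k l := by
  have h : (uatfMatrix S W C k l * (uatfMatrix S W C k l)ᴴ).trace =
      (Wᴴ * (channelMatrix S C l * (channelMatrix S C l)ᴴ) * W *
        (estimateMatrix S C k * (estimateMatrix S C k)ᴴ)).trace := by
    simp only [uatfMatrix, Matrix.conjTranspose_mul, Matrix.conjTranspose_conjTranspose,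
      Matrix.mul_assoc]
    rw [Matrix.trace_mul_comm]
    simp only [Matrix.mul_assoc]
  have ht : S.totalCorr k = S.losGram k + S.estCorr k := rfl
  rw [← trace_mul_conjTranspose_self, h, channelMatrix_mul_conjTranspose S hC,
    estimateMatrix_mul_conjTranspose S hC, ht, Network.mu]
  simp only [Matrix.mul_add, Matrix.add_mul, Matrix.trace_add]
  ring

/-- The excess-kurtosis term: it vanishes on the Gaussian coordinates, and on the phase
coordinates unless `l = k`, as `g_l` and `ĝ_k` share no phase otherwise. -/
lemma sum_diag_uatfMatrix (k l : Fin K) :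
    ∑ a, (sourceKurtosis a - 2) * ‖uatfMatrix S W C k l a a‖ ^ 2 =
      if l = k then -∑ m, ‖losForm S W k m m‖ ^ 2 else 0 := by
  have hd (p : Fin M × Fin K) : uatfMatrix S W C k l (.inl p) (.inl p) =
      star (((losCols S l)ᴴ * W * losCols S k) p p) := by
    rw [← Matrix.conjTranspose_apply, Matrix.conjTranspose_mul, Matrix.conjTranspose_mul,
      Matrix.conjTranspose_conjTranspose, ← Matrix.mul_assoc, ← Matrix.conjTranspose_mul]
    rfl
  rw [Fintype.sum_sum_type]
  simp only [sourceKurtosis, Sum.elim_inl, Sum.elim_inr, sub_self, zero_mul,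
    Finset.sum_const_zero, add_zero, hd, norm_star, losCols_conjTranspose_mul_mul,
    Fintype.sum_prod_type]
  split_ifs with h
  · subst h
    rw [← Finset.sum_neg_distrib]
    refine Finset.sum_congr rfl fun m _ => ?_
    rw [Finset.sum_eq_single l (fun b _ hb => by simp [hb]) (by simp)]
    simp [losForm]
    norm_num
  · refine Finset.sum_eq_zero fun m _ => Finset.sum_eq_zero fun b _ => ?_
    by_cases hb : b = l
    · simp [hb, h]
    · simp [hb]

/-- The closed form of `E {|v_kᴴ g_l|²}`. -/
theorem integral_norm_sq_uatfMatrix (hC : Factors S C) (k l : Fin K) :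
    ((∫ x, ‖star x ⬝ᵥ uatfMatrix S W C k l *ᵥ x‖ ^ 2 ∂(Measure.pi sourceLaw) : ℝ) : ℂ) =
      S.mu W k l + (if l ∈ S.copilot k then (S.eps W k l : ℂ) else 0)
        + if l = k then S.omega W k else 0 := by
  rw [integral_norm_sq_quadraticForm isCircular_sourceLaw, sum_diag_uatfMatrix,
    ← sum_norm_sq_uatfMatrix S W hC]
  by_cases h : l = k
  · subst h
    -- the `ε_kk` in the second summand cancels the one subtracted in `omega_eq`
    rw [trace_uatfMatrix_self S W hC, omega_eq S W l hC]
    simp only [if_true, Network.copilot, Finset.mem_filter, Finset.mem_univ, true_and]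
    push_cast
    ring
  · rw [norm_sq_trace_uatfMatrix S W hC h]
    simp only [h, if_false]
    push_cast
    split_ifs <;> push_cast <;> ring

end ClosedForm

/-! ### The expectations in the UatF bound -/

section Expectations

variable {M N K τp : ℕ} {S : Network M N K τp} {Ω : Type*} [MeasurableSpace Ω] {P : Measure Ω}
  {B : Block S Ω P} {C : Fin M → Fin K → Matrix (Fin N) (Fin N) ℂ}

lemma star_dotProduct_eq_quadraticForm {m ι : Type*} [Fintype m] [Fintype ι]
    (A D : Matrix m ι ℂ) (x : ι → ℂ) : star (A *ᵥ x) ⬝ᵥ D *ᵥ x = star x ⬝ᵥ (Aᴴ * D) *ᵥ x := by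
  rw [Matrix.star_mulVec, ← Matrix.dotProduct_mulVec, Matrix.mulVec_mulVec]

lemma ofReal_sum_norm_sq {m : Type*} [Fintype m] (v : m → ℂ) :
    ((∑ i, ‖v i‖ ^ 2 : ℝ) : ℂ) = star v ⬝ᵥ v := by
  simp [dotProduct, Complex.conj_mul']

lemma Block.identDistrib_combiner_channel (W : Matrix (Idx M N) (Idx M N) ℂ)
    (h : IdentDistrib B.primitives (primitivesOfSource S C) P (Measure.pi sourceLaw))
    (k l : Fin K) :
    IdentDistrib (fun ω => star (B.combiner W k ω) ⬝ᵥ B.channel l ω)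
      (fun x => star x ⬝ᵥ uatfMatrix S W C k l *ᵥ x) P (Measure.pi sourceLaw) := by
  have hm : Measurable fun t : Primitives M N K τp =>
      star (W *ᵥ estimateOf S k t) ⬝ᵥ channelOf S l t := by
    have h1 := (measurable_mulVec_const W).comp (measurable_estimateOf S k)
    have h2 := measurable_channelOf S l
    refine Finset.measurable_sum _ fun i _ => ?_
    exact (continuous_star.measurable.comp ((measurable_pi_apply i).comp h1)).mul
      ((measurable_pi_apply i).comp h2)
  convert h.comp hm using 1
  · ext ω
    simp only [Function.comp, Block.combiner, B.estimate_eq_estimateOf, B.channel_eq_channelOf]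
  · ext x
    simp only [Function.comp, estimateOf_primitivesOfSource, channelOf_primitivesOfSource,
      Matrix.mulVec_mulVec, star_dotProduct_eq_quadraticForm]
    rfl

lemma Block.identDistrib_combiner_norm_sq (W : Matrix (Idx M N) (Idx M N) ℂ)
    (h : IdentDistrib B.primitives (primitivesOfSource S C) P (Measure.pi sourceLaw))
    (k : Fin K) :
    IdentDistrib (fun ω => ((∑ i, ‖B.combiner W k ω i‖ ^ 2 : ℝ) : ℂ))
      (fun x => star x ⬝ᵥ ((W * estimateMatrix S C k)ᴴ * (W * estimateMatrix S C k)) *ᵥ x) P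
      (Measure.pi sourceLaw) := by
  have hm : Measurable fun t : Primitives M N K τp =>
      ((∑ i, ‖(W *ᵥ estimateOf S k t) i‖ ^ 2 : ℝ) : ℂ) := by
    have h1 := (measurable_mulVec_const W).comp (measurable_estimateOf S k)
    refine Complex.measurable_ofReal.comp (Finset.measurable_sum _ fun i _ => ?_)
    exact ((measurable_pi_apply i).comp h1).norm.pow_const 2
  convert h.comp hm using 1
  · ext ω
    simp only [Function.comp, Block.combiner, B.estimate_eq_estimateOf]
  · ext x
    simp only [Function.comp, estimateOf_primitivesOfSource, Matrix.mulVec_mulVec,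
      ofReal_sum_norm_sq, star_dotProduct_eq_quadraticForm]

lemma norm_integral_sq_le {X : Ω → ℂ} [IsProbabilityMeasure P] (hX : Integrable X P)
    (hX2 : Integrable (fun ω => ‖X ω‖ ^ 2) P) :
    ‖∫ ω, X ω ∂P‖ ^ 2 ≤ ∫ ω, ‖X ω‖ ^ 2 ∂P := by
  refine (pow_le_pow_left₀ (norm_nonneg _) (norm_integral_le_integral_norm X) 2).trans ?_
  exact (even_two.convexOn_pow (𝕜 := ℝ)).map_integral_le (by fun_prop) isClosed_univ
    (by simp) hX.norm hX2

end Expectations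

end CellFree

end

theorem theorem1 {M N K τp : ℕ} (S : CellFree.Network M N K τp)
    {Ω : Type*} [MeasurableSpace Ω] (P : Measure Ω) [IsProbabilityMeasure P]
    (B : CellFree.Block S Ω P) (τc : ℕ) (hτ : τp ≤ τc) (k : Fin K)
    (W : Matrix (CellFree.Idx M N) (CellFree.Idx M N) ℂ) :
    -- all expectations in the bound exist
    (∀ l, Integrable (fun ω => star (B.combiner W k ω) ⬝ᵥ B.channel l ω) P) ∧
    (∀ l, Integrable (fun ω => ‖star (B.combiner W k ω) ⬝ᵥ B.channel l ω‖ ^ 2) P) ∧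
    Integrable (fun ω => ∑ i, ‖B.combiner W k ω i‖ ^ 2) P ∧
    -- the denominator of the SINR is positive unless the combiner vanishes almost surely
    (¬ (∀ᵐ ω ∂P, B.combiner W k ω = 0) → 0 < B.uatfDen (B.combiner W k) k) ∧
    -- the closed forms of the SINR and of the SE
    (B.uatfSINR (B.combiner W k) k : ℂ) = S.closedSINR W k ∧
    B.uatfSE (B.combiner W k) τc k = S.closedSE W τc k := by
  classical
  obtain ⟨C, hC, hident⟩ := B.exists_identDistrib_primitives
  have hX := B.identDistrib_combiner_channel W hident k
  have hX2 (l : Fin K) := (hX l).comp (u := fun z => ‖z‖ ^ 2) (by fun_prop)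
  have hV := B.identDistrib_combiner_norm_sq W hident k
  have hcirc := CellFree.isCircular_sourceLaw (M := M) (N := N) (K := K) (τp := τp)
  have iX (l : Fin K) : Integrable (fun ω => star (B.combiner W k ω) ⬝ᵥ B.channel l ω) P :=
    (hX l).integrable_iff.2 (CellFree.integrable_quadraticForm hcirc _)
  have iX2 (l : Fin K) :
      Integrable (fun ω => ‖star (B.combiner W k ω) ⬝ᵥ B.channel l ω‖ ^ 2) P :=
    (hX2 l).integrable_iff.2 (CellFree.integrable_norm_sq_quadraticForm hcirc _)
  have iV : Integrable (fun ω => ∑ i, ‖B.combiner W k ω i‖ ^ 2) P := by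
    have := (hV.integrable_iff.2 (CellFree.integrable_quadraticForm hcirc _)).re
    simpa only [RCLike.re_to_complex, Complex.ofReal_re] using this
  have eX : ∫ ω, star (B.combiner W k ω) ⬝ᵥ B.channel k ω ∂P = (Wᴴ * S.totalCorr k).trace := by
    rw [(hX k).integral_eq, CellFree.integral_quadraticForm hcirc,
      CellFree.trace_uatfMatrix_self S W hC]
  have eX2 (l : Fin K) :
      ((∫ ω, ‖star (B.combiner W k ω) ⬝ᵥ B.channel l ω‖ ^ 2 ∂P : ℝ) : ℂ) = S.mu W k l
        + (if l ∈ S.copilot k then (S.eps W k l : ℂ) else 0)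
        + if l = k then S.omega W k else 0 := by
    rw [← CellFree.integral_norm_sq_uatfMatrix S W hC]
    exact congrArg _ (hX2 l).integral_eq
  have eV : ((∫ ω, ∑ i, ‖B.combiner W k ω i‖ ^ 2 ∂P : ℝ) : ℂ) =
      (W * S.totalCorr k * Wᴴ).trace := by
    rw [← integral_complex_ofReal, hV.integral_eq, CellFree.integral_quadraticForm hcirc,
      Matrix.trace_mul_comm, Matrix.conjTranspose_mul, ← Matrix.mul_assoc, Matrix.mul_assoc W,
      CellFree.estimateMatrix_mul_conjTranspose S hC]
  have hSINR : (B.uatfSINR (B.combiner W k) k : ℂ) = S.closedSINR W k := by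
    rw [CellFree.Block.uatfSINR, CellFree.Block.uatfNum, CellFree.Block.uatfDen,
      CellFree.Network.closedSINR, eX, Complex.ofReal_div]
    congr 1
    simp only [Complex.ofReal_add, Complex.ofReal_sub, Complex.ofReal_sum]
    rw [Complex.ofReal_mul (S.sigma ^ 2), eV]
    congr 2
    simp_rw [Complex.ofReal_mul, eX2, mul_add, Finset.sum_add_distrib, mul_ite, mul_zero]
    simp [CellFree.Network.copilot, Finset.sum_ite]
  refine ⟨iX, iX2, iV, fun hv => ?_, hSINR, ?_⟩
  · have hpos : 0 < ∫ ω, ∑ i, ‖B.combiner W k ω i‖ ^ 2 ∂P := by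
      have h0 (ω : Ω) : 0 ≤ ∑ i, ‖B.combiner W k ω i‖ ^ 2 :=
        Finset.sum_nonneg fun i _ => by positivity
      refine lt_of_le_of_ne (integral_nonneg h0) fun h => hv ?_
      filter_upwards [(integral_eq_zero_iff_of_nonneg h0 iV).1 h.symm] with ω hω
      ext i
      have := (Finset.sum_eq_zero_iff_of_nonneg fun i _ => by positivity).1 hω i
        (Finset.mem_univ i)
      simpa using this
    have hk := mul_le_mul_of_nonneg_left (CellFree.norm_integral_sq_le (iX k) (iX2 k))
      (S.power_nonneg k)
    have hs := Finset.single_le_sum (f := fun l => S.power l *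
        ∫ ω, ‖star (B.combiner W k ω) ⬝ᵥ B.channel l ω‖ ^ 2 ∂P)
      (fun l _ => mul_nonneg (S.power_nonneg l) (integral_nonneg fun ω => by positivity))
      (Finset.mem_univ k)
    have := mul_pos (pow_pos S.sigma_pos 2) hpos
    rw [CellFree.Block.uatfDen]
    linarith
  · rw [CellFree.Block.uatfSE, CellFree.Network.closedSE, ← hSINR, Complex.ofReal_re]
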